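/- Let $n\ge 1$ and $0\le q<1$. For $0\le r<1$ let $\mathrm{Geo}(1-r)$ denote the distribution on $\{0,1,2,\dots\}$ with mass $(1-r)r^k$ at $k$. Given non-negative integer-valued random weights $(w_{i,j})_{1\le i,j\le n}$, the last passage time from $(1,1)$ to $(n,n)$ is $$L=\max_\gamma \sum_{v\in\gamma} w_v ,$$ where the maximum is over all up/right lattice paths $\gamma$ from $(1,1)$ to $(n,n)$ (each step is $(1,0)$ or $(0,1)$, and both endpoints are included). Write $L$ as - $G^{(2)}_{\mathbf 1,\mathbf n}$, if the $w_{i,j}$ are i.i.d. with distribution $\mathrm{Geo}(1-q)$; - $G^{(4)}_{\mathbf 1,\mathbf n}$, if $w_{i,j}=w_{j,i}$ for all $i,j$, the weights are otherwise independent (i.e. $(w_{i,j})_{i\le j}$ are independent), and $w_{i,j}$ has distribution $\mathrm{Geo}(1-q)$ when $i\ne j$ and $\mathrm{Geo}(1-\sqrt q)$ when $i=j$; - $G^{(1)}_{\mathbf 1,\mathbf n}$, if $w_{i,j}=w_{n+1-j,\,n+1-i}$ for all $i,j$, the weights are otherwise independent (i.e. $(w_{i,j})_{i+j\le n+1}$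 are independent), and $w_{i,j}$ has distribution $\mathrm{Geo}(1-q)$ when $i+j\le n$ and $\mathrm{Geo}(1-\sqrt q)$ when $i+j=n+1$. Then each of $G^{(1)}_{\mathbf 1,\mathbf n}$, $G^{(2)}_{\mathbf 1,\mathbf n}$, $G^{(4)}_{\mathbf 1,\mathbf n}$ has a log-concave distribution: its probability mass function $p(k)$, $k\in\mathbb Z$, satisfies $p(k)^2\ge p(k-1)\,p(k+1)$ for all $k\in\mathbb Z$ and has no internal zeros (if $i<j<k$ and $p(i),p(k)>0$ then $p(j)>0$). -/

import Mathlib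

open MeasureTheory ProbabilityTheory

/-- A sequence indexed by `ℤ` is log-concave if it is non-negative, satisfies
`a (k-1) * a (k+1) ≤ a k ^ 2` for all `k`, and has no internal zeros. -/
def IsLogConcaveSeq (a : ℤ → ℝ) : Prop :=
  (∀ k, 0 ≤ a k) ∧
  (∀ k, a (k - 1) * a (k + 1) ≤ a k ^ 2) ∧
  (∀ i j k, i < j → j < k → a i ≠ 0 → a k ≠ 0 → a j ≠ 0)

/-- The integer-valued random variable `X` has a log-concave distribution under `μ`:
its probability mass function on `ℤ` is a log-concave sequence. -/
def HasLogConcaveLaw {Ω : Type*} [MeasurableSpace Ω] (X : Ω → ℕ) (μ : Measure Ω) : Prop :=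
  IsLogConcaveSeq fun k : ℤ => μ.real {ω | (X ω : ℤ) = k}

/-! ### Last passage times -/

/-- `γ` lists the successive vertices of an up/right lattice path from `a` to `b`. -/
def IsUpRightPath (a b : ℕ × ℕ) (γ : List (ℕ × ℕ)) : Prop :=
  γ.head? = some a ∧ γ.getLast? = some b ∧
    γ.IsChain fun u v => v = (u.1 + 1, u.2) ∨ v = (u.1, u.2 + 1)

/-- The passage time from `a` to `b` in the environment `ζ`: the maximum over all up/right paths
from `a` to `b` of the sum of the weights of the vertices of the path. (It is a genuine maximum
whenever a path exists, see `isGreatest_passageTime`.) -/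
noncomputable def passageTime (ζ : ℕ × ℕ → ℕ) (a b : ℕ × ℕ) : ℕ :=
  sSup {s | ∃ γ, IsUpRightPath a b γ ∧ s = (γ.map ζ).sum}

theorem IsUpRightPath.subset_and_nodup {b : ℕ × ℕ} : ∀ (γ : List (ℕ × ℕ)) {a : ℕ × ℕ},
    IsUpRightPath a b γ → (∀ p ∈ γ, p ∈ Finset.Icc a b) ∧ γ.Nodup := by
  intro γ
  induction γ with
  | nil => intro a h; simp [IsUpRightPath] at h
  | cons x l ih =>
    intro a h
    obtain ⟨h1, h2, h3⟩ := h
    simp only [List.head?_cons, Option.some.injEq] at h1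
    subst h1
    cases l with
    | nil =>
      simp only [List.getLast?_singleton, Option.some.injEq] at h2
      subst h2
      simp
    | cons y l' =>
      rw [List.isChain_cons_cons] at h3
      obtain ⟨hm, hn⟩ := ih (a := y) ⟨rfl, by simpa using h2, h3.2⟩
      have hxy : x ≤ y ∧ ¬ y ≤ x := by
        rcases h3.1 with h | h <;> subst h <;> simp [Prod.le_def]
      have hyb : y ≤ b := (Finset.mem_Icc.1 (hm y (by simp))).2
      refine ⟨?_, ?_⟩
      · intro p hp
        rcases List.mem_cons.1 hp with rfl | hp
        · exact Finset.mem_Icc.2 ⟨le_rfl, hxy.1.trans hyb⟩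
        · have := Finset.mem_Icc.1 (hm p hp)
          exact Finset.mem_Icc.2 ⟨hxy.1.trans this.1, this.2⟩
      · refine List.nodup_cons.2 ⟨fun hx => ?_, hn⟩
        exact hxy.2 (Finset.mem_Icc.1 (hm x hx)).1

theorem exists_isUpRightPath : ∀ (d : ℕ) (a b : ℕ × ℕ), a ≤ b → (b.1 - a.1) + (b.2 - a.2) = d →
    ∃ γ, IsUpRightPath a b γ := by
  intro d
  induction d with
  | zero =>
    rintro ⟨a1, a2⟩ ⟨b1, b2⟩ hab hd
    rw [Prod.mk_le_mk] at hab
    obtain ⟨rfl, rfl⟩ : a1 = b1 ∧ a2 = b2 := by simp only at hd; omega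
    exact ⟨[(a1, a2)], by simp [IsUpRightPath]⟩
  | succ d ih =>
    rintro ⟨a1, a2⟩ ⟨b1, b2⟩ hab hd
    rw [Prod.mk_le_mk] at hab
    simp only at hd
    have key : ∀ c : ℕ × ℕ, (c = (a1 + 1, a2) ∨ c = (a1, a2 + 1)) → c ≤ (b1, b2) →
        (b1 - c.1) + (b2 - c.2) = d → ∃ γ, IsUpRightPath (a1, a2) (b1, b2) γ := by
      intro c hc hcb hcd
      obtain ⟨γ, g1, g2, g3⟩ := ih c (b1, b2) hcb hcd
      cases γ with
      | nil => simp at g1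
      | cons y l =>
        simp only [List.head?_cons, Option.some.injEq] at g1
        subst g1
        exact ⟨(a1, a2) :: y :: l, rfl, by simpa using g2, List.isChain_cons_cons.2 ⟨hc, g3⟩⟩
    by_cases h : a1 < b1
    · exact key (a1 + 1, a2) (Or.inl rfl) (Prod.mk_le_mk.2 ⟨h, hab.2⟩) (by simp only; omega)
    · exact key (a1, a2 + 1) (Or.inr rfl) (Prod.mk_le_mk.2 ⟨hab.1, by omega⟩) (by simp only; omega)

theorem isGreatest_passageTime (ζ : ℕ × ℕ → ℕ) {a b : ℕ × ℕ} (hab : a ≤ b) :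
    IsGreatest {s | ∃ γ, IsUpRightPath a b γ ∧ s = (γ.map ζ).sum} (passageTime ζ a b) := by
  have hbdd : BddAbove {s | ∃ γ, IsUpRightPath a b γ ∧ s = (γ.map ζ).sum} := by
    refine ⟨∑ p ∈ Finset.Icc a b, ζ p, ?_⟩
    rintro _ ⟨γ, hγ, rfl⟩
    obtain ⟨hm, hn⟩ := IsUpRightPath.subset_and_nodup γ hγ
    rw [← List.sum_toFinset ζ hn]
    exact Finset.sum_le_sum_of_subset fun p hp => hm p (List.mem_toFinset.1 hp)
  obtain ⟨γ, hγ⟩ := exists_isUpRightPath _ a b hab rfl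
  exact ⟨Nat.sSup_mem ⟨_, γ, hγ, rfl⟩ hbdd, fun s hs => le_csSup hbdd hs⟩

/-- The last passage time from `(1,1)` to `(n,n)` as a random variable, for random weights `w`. -/
noncomputable def lastPassage {Ω : Type*} (n : ℕ) (w : ℕ × ℕ → Ω → ℕ) (ω : Ω) : ℕ :=
  passageTime (fun p => w p ω) (1, 1) (n, n)

/-! ### The three random environments on `{1,…,n}²` -/

/-- The square root as a map of the unit interval to itself. -/
noncomputable def unitSqrt (q : unitInterval) : unitInterval :=
  ⟨√(q : ℝ), Real.sqrt_nonneg _, Real.sqrt_le_one.2 q.2.2⟩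

/-- `Geo(1 - q)`, the measure on `ℕ` giving mass `(1 - q) * q ^ k` to `k`, for `0 ≤ q < 1`. -/
noncomputable def geo (q : unitInterval) : Measure ℕ := geometricMeasure (unitInterval.symm q)

theorem geo_singleton (q : unitInterval) (hq : q < 1) (k : ℕ) :
    geo q {k} = ENNReal.ofReal ((1 - (q : ℝ)) * (q : ℝ) ^ k) := by
  have h : unitInterval.symm q ≠ 0 := by
    intro h
    have h' := congrArg Subtype.val h
    have hq' : (q : ℝ) < 1 := hq
    simp only [unitInterval.coe_symm_eq, Set.Icc.coe_zero] at h'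
    linarith
  rw [geo, geometricMeasure_singleton h, unitInterval.coe_symm_eq, sub_sub_cancel, mul_comm]

section Environments

variable {Ω : Type*} [MeasurableSpace Ω]

/-- Independent weights, all with distribution `Geo(1 - q)`. -/
structure IsIIDEnvironment (n : ℕ) (q : unitInterval) (w : ℕ × ℕ → Ω → ℕ) (μ : Measure Ω) :
    Prop where
  law : ∀ p ∈ Set.Icc (1, 1) (n, n), HasLaw (w p) (geo q) μ
  indep : iIndepFun (fun p : {p : ℕ × ℕ // p ∈ Set.Icc (1, 1) (n, n)} => w p) μ

/-- Weights symmetric about the main diagonal, `w (i,j) = w (j,i)`, otherwise independent,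
with distribution `Geo(1 - q)` off the diagonal and `Geo(1 - √q)` on it. -/
structure IsSymmetricEnvironment (n : ℕ) (q : unitInterval) (w : ℕ × ℕ → Ω → ℕ) (μ : Measure Ω) :
    Prop where
  symm : ∀ i j, (i, j) ∈ Set.Icc (1, 1) (n, n) → w (i, j) = w (j, i)
  law_off : ∀ i j, (i, j) ∈ Set.Icc (1, 1) (n, n) → i ≠ j → HasLaw (w (i, j)) (geo q) μ
  law_diag : ∀ i, (i, i) ∈ Set.Icc (1, 1) (n, n) → HasLaw (w (i, i)) (geo (unitSqrt q)) μ
  indep : iIndepFun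
    (fun p : {p : ℕ × ℕ // p ∈ Set.Icc (1, 1) (n, n) ∧ p.1 ≤ p.2} => w p) μ

/-- Weights symmetric about the anti-diagonal, `w (i,j) = w (n+1-j,n+1-i)`, otherwise independent,
with distribution `Geo(1 - q)` when `i + j ≤ n` and `Geo(1 - √q)` when `i + j = n + 1`. -/
structure IsAntiSymmetricEnvironment (n : ℕ) (q : unitInterval) (w : ℕ × ℕ → Ω → ℕ)
    (μ : Measure Ω) : Prop where
  symm : ∀ i j, (i, j) ∈ Set.Icc (1, 1) (n, n) → w (i, j) = w (n + 1 - j, n + 1 - i)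
  law_off : ∀ i j, (i, j) ∈ Set.Icc (1, 1) (n, n) → i + j ≤ n → HasLaw (w (i, j)) (geo q) μ
  law_anti : ∀ i j, (i, j) ∈ Set.Icc (1, 1) (n, n) → i + j = n + 1 →
    HasLaw (w (i, j)) (geo (unitSqrt q)) μ
  indep : iIndepFun
    (fun p : {p : ℕ × ℕ // p ∈ Set.Icc (1, 1) (n, n) ∧ p.1 + p.2 ≤ n + 1} => w p) μ

end Environments

/-!
The three distributions are log-concave because each of them counts plane partitions by their corner
entry. Let `e` be an `n × n` matrix of non-negative integers with last passage time `L`. The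
Robinson–Schensted–Knuth correspondence sends `e` to a pair of semistandard tableaux of a common shape
`λ` with `λ₁ = L` and `|λ| = ∑ e`. Gluing the two tableaux (as Gelfand–Tsetlin patterns) along `λ`
yields a plane partition in an `n × n` square whose corner entry is `L` and whose diagonal sum is `∑ e`.
Since the weights are geometric, a matrix has probability proportional to `z ^ ∑ e`, with `z = q` for
independent weights and `z = √q` for the two symmetric environments, so that `P(L = k)` is proportional
to the sum of `z ^ (diagonal sum)` over the plane partitions with corner `k`.

*Log-concavity* (`traceCount_mul_le`). If `π` and `σ` are plane partitions with corners `k - 1` and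
`k + 1`, then `(π + 1) ⊓ σ` and `(π + 1) ⊔ σ - 1` are plane partitions with corner `k` and the same
total diagonal sum, and both are symmetric if `π` and `σ` are. The inequality is therefore an instance
of the four functions theorem.

*The correspondence* (`bijOn_toPlanePartition`) is built from Fomin's growth diagram: `part e k i j` is
the `k`-th part of the partition attached to the first `i` rows and `j` columns. Its local rule
(`part_succ_succ`) can be run backwards, which gives bijectivity. Transposing `e` exchanges the two
tableaux, so symmetric matrices correspond to symmetric plane partitions.

*Symmetry about the anti-diagonal* (`bijOn_doubledTableau`). Such a matrix has the property that its
rotation by 180° is its transpose, so the second tableau of `e` is the first tableau of the rotated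
matrix. The latter is a function of the first tableau of `e` (`part_rotateMatrix_congr`), hence `e` is
determined by its first tableau, and doubling this tableau maps these matrices injectively to symmetric
plane partitions. Reflecting the rows shows that for each total there are as many of them as symmetric
matrices, that is, as symmetric plane partitions, so the map is onto.

That the tableau of the rotation depends only on the tableau is shown without words and Knuth relations.
Inserting a row into another one preserves the passage times through the two rows between any two
columns (`pairLE_bumpedRow_insertRow`, an instance of Pitman's transform). Call two pairs of rows
equivalent if these passage times agree; this notion is invariant under rotation. Equivalent pairs,
inserted in the same row, give the same row and bump out equivalent pairs (`PairEquiv.insert`), so that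
replacing adjacent rows of a matrix by an equivalent pair does not change its tableau. As insertion
itself consists of such replacements, a matrix is equivalent to its own tableau, and the rotated matrix
to the rotated tableau.
-/

/-! ### Growth diagrams -/

/-- Passage values of the integer weights `e`: `lpp e i j` is the maximal weight of an up/right path
through the rectangle formed by the first `i` rows and the first `j` columns (rows and columns of `e`
are numbered from `0`). -/
def lpp (e : ℕ → ℕ → ℤ) : ℕ → ℕ → ℤ
  | 0, _ => 0
  | _ + 1, 0 => 0
  | i + 1, j + 1 => max (lpp e i (j + 1)) (lpp e (i + 1) j) + e i j

/-- The weights that the Robinson–Schensted–Knuth correspondence hands on to the next row of the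
tableau once `lpp e` has been recorded as the first row. -/
def bumped (e : ℕ → ℕ → ℤ) (i j : ℕ) : ℤ :=
  min (lpp e i (j + 1)) (lpp e (i + 1) j) - lpp e i j

/-- `part e k i j` is the `k`-th part (counted from `0`) of the partition which the
Robinson–Schensted–Knuth correspondence attaches to the first `i` rows and first `j` columns
of `e`. -/
def part (e : ℕ → ℕ → ℤ) (k : ℕ) : ℕ → ℕ → ℤ := lpp (bumped^[k] e)

/-- `e` is a matrix with non-negative entries, extended by zero outside `n` rows and `n` columns. -/
structure IsWeightMatrix (n : ℕ) (e : ℕ → ℕ → ℤ) : Prop where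
  nonneg : ∀ i j, 0 ≤ e i j
  zero : ∀ i j, n ≤ i ∨ n ≤ j → e i j = 0

/-- The sum of the entries of an `n × n` matrix. -/
def total (n : ℕ) (e : ℕ → ℕ → ℤ) : ℤ := ∑ i ∈ Finset.range n, ∑ j ∈ Finset.range n, e i j

section lpp

variable {e : ℕ → ℕ → ℤ}

@[simp] theorem lpp_zero_left (j : ℕ) : lpp e 0 j = 0 := by simp [lpp]

@[simp] theorem lpp_zero_right (i : ℕ) : lpp e i 0 = 0 := by cases i <;> simp [lpp]

theorem lpp_succ (i j : ℕ) :
    lpp e (i + 1) (j + 1) = max (lpp e i (j + 1)) (lpp e (i + 1) j) + e i j := by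
  simp [lpp]

theorem lpp_le_left (he : ∀ i j, 0 ≤ e i j) (i j : ℕ) : lpp e i j ≤ lpp e (i + 1) j := by
  cases j with
  | zero => simp
  | succ j => rw [lpp_succ]; have := he i j; have := le_max_left (lpp e i (j + 1)) (lpp e (i + 1) j); omega

theorem lpp_le_right (he : ∀ i j, 0 ≤ e i j) (i j : ℕ) : lpp e i j ≤ lpp e i (j + 1) := by
  cases i with
  | zero => simp
  | succ i => rw [lpp_succ]; have := he i j; have := le_max_right (lpp e i (j + 1)) (lpp e (i + 1) j); omega

theorem lpp_transpose (i j : ℕ) : lpp (fun i j => e j i) i j = lpp e j i := by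
  induction i generalizing j with
  | zero => simp
  | succ i ih =>
    induction j with
    | zero => simp
    | succ j ihj => rw [lpp_succ, lpp_succ, ih, ihj, max_comm]

/-- The passage values of a rectangle depend only on the weights inside of it. -/
theorem lpp_congr {e' : ℕ → ℕ → ℤ} {a b : ℕ} (h : ∀ i < a, ∀ j < b, e i j = e' i j) :
    ∀ i ≤ a, ∀ j ≤ b, lpp e i j = lpp e' i j := by
  intro i
  induction i with
  | zero => simp
  | succ i ih =>
    intro hi j
    induction j with
    | zero => simp
    | succ j ihj =>
      intro hj
      rw [lpp_succ, lpp_succ, ih (by omega) _ hj, ihj (by omega), h i (by omega) j (by omega)]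

theorem lpp_eq_zero {a b : ℕ} (h : ∀ i < a, ∀ j < b, e i j = 0) : lpp e a b = 0 := by
  have h0 : ∀ i j, lpp (fun _ _ => 0) i j = 0 := by
    intro i
    induction i with
    | zero => simp
    | succ i ih =>
      intro j
      induction j with
      | zero => simp
      | succ j ihj => simp [lpp_succ, ih, ihj]
  rw [lpp_congr (e' := fun _ _ => 0) h a le_rfl b le_rfl, h0]

theorem bumped_nonneg (he : ∀ i j, 0 ≤ e i j) (i j : ℕ) : 0 ≤ bumped e i j := by
  have h1 := lpp_le_left he i j
  have h2 := lpp_le_right he i j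
  simp only [bumped]
  omega

theorem bumped_transpose : bumped (fun i j => e j i) = fun i j => bumped e j i := by
  funext i j
  simp only [bumped, lpp_transpose]
  rw [min_comm]

theorem bumped_eq (i j : ℕ) :
    bumped e i j = e i j + lpp e i (j + 1) + lpp e (i + 1) j - lpp e i j
      - lpp e (i + 1) (j + 1) := by
  rw [lpp_succ, bumped]
  have := min_add_max (lpp e i (j + 1)) (lpp e (i + 1) j)
  omega

/-- Passing to the bumped weights removes exactly the recorded passage value. -/
theorem total_bumped (n : ℕ) : total n (bumped e) = total n e - lpp e n n := by
  have h : ∀ a b, ∑ i ∈ Finset.range a, ∑ j ∈ Finset.range b, bumped e i j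
      = ∑ i ∈ Finset.range a, ∑ j ∈ Finset.range b, e i j - lpp e a b := by
    intro a b
    induction a with
    | zero => simp
    | succ a ih =>
      have hr : ∑ j ∈ Finset.range b, bumped e a j
          = ∑ j ∈ Finset.range b, e a j + lpp e a b - lpp e (a + 1) b := by
        clear ih
        induction b with
        | zero => simp
        | succ b ihb =>
          rw [Finset.sum_range_succ, ihb, Finset.sum_range_succ, bumped_eq]
          ring
      rw [Finset.sum_range_succ, ih, hr, Finset.sum_range_succ]
      ring
  exact h n n

end lpp

section part

variable {e : ℕ → ℕ → ℤ}

theorem part_zero (i j : ℕ) : part e 0 i j = lpp e i j := rfl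

@[simp] theorem part_zero_left (k j : ℕ) : part e k 0 j = 0 := lpp_zero_left j

@[simp] theorem part_zero_right (k i : ℕ) : part e k i 0 = 0 := lpp_zero_right i

theorem part_zero_succ (i j : ℕ) :
    part e 0 (i + 1) (j + 1) = max (part e 0 i (j + 1)) (part e 0 (i + 1) j) + e i j := lpp_succ i j

/-- The local rule of the growth diagram. -/
theorem part_succ_succ (k i j : ℕ) :
    part e (k + 1) (i + 1) (j + 1) = max (part e (k + 1) i (j + 1)) (part e (k + 1) (i + 1) j)
      + min (part e k i (j + 1)) (part e k (i + 1) j) - part e k i j := by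
  simp only [part, Function.iterate_succ_apply']
  rw [lpp_succ, bumped]
  ring

theorem iterate_bumped_nonneg (he : ∀ i j, 0 ≤ e i j) (k : ℕ) : ∀ i j, 0 ≤ bumped^[k] e i j := by
  induction k with
  | zero => simpa using he
  | succ k ih => rw [Function.iterate_succ_apply']; exact bumped_nonneg ih

theorem lpp_nonneg (he : ∀ i j, 0 ≤ e i j) (i j : ℕ) : 0 ≤ lpp e i j := by
  induction i with
  | zero => simp
  | succ i ih => exact ih.trans (lpp_le_left he i j)

theorem iterate_bumped_eq_zero (he : ∀ i j, 0 ≤ e i j) (k : ℕ) :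
    ∀ i j, i < k ∨ j < k → bumped^[k] e i j = 0 := by
  induction k with
  | zero => simp
  | succ k ih =>
    intro i j hij
    have hn := lpp_nonneg (iterate_bumped_nonneg he k)
    rw [Function.iterate_succ_apply', bumped]
    rcases hij with hi | hj
    · rw [lpp_eq_zero (a := i) (b := j + 1) (fun a ha b hb => ih a b (by omega)),
        lpp_eq_zero (a := i) (b := j) (fun a ha b hb => ih a b (by omega)),
        min_eq_left (hn _ _), sub_self]
    · rw [lpp_eq_zero (a := i + 1) (b := j) (fun a ha b hb => ih a b (by omega)),
        lpp_eq_zero (a := i) (b := j) (fun a ha b hb => ih a b (by omega)),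
        min_eq_right (hn _ _), sub_self]

theorem part_eq_zero (he : ∀ i j, 0 ≤ e i j) {k i j : ℕ} (h : i ≤ k ∨ j ≤ k) :
    part e k i j = 0 :=
  lpp_eq_zero fun a ha b hb => iterate_bumped_eq_zero he k a b (by omega)

theorem part_le_left (he : ∀ i j, 0 ≤ e i j) (k i j : ℕ) : part e k i j ≤ part e k (i + 1) j :=
  lpp_le_left (iterate_bumped_nonneg he k) i j

theorem part_le_right (he : ∀ i j, 0 ≤ e i j) (k i j : ℕ) : part e k i j ≤ part e k i (j + 1) :=
  lpp_le_right (iterate_bumped_nonneg he k) i j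

theorem part_nonneg (he : ∀ i j, 0 ≤ e i j) (k i j : ℕ) : 0 ≤ part e k i j :=
  lpp_nonneg (iterate_bumped_nonneg he k) i j

/-- Neighbouring partitions of the growth diagram interlace. -/
theorem part_interlace (he : ∀ i j, 0 ≤ e i j) (k i j : ℕ) :
    part e (k + 1) (i + 1) j ≤ part e k i j ∧ part e (k + 1) i (j + 1) ≤ part e k i j := by
  induction i generalizing j with
  | zero => simp [part_eq_zero he (k := k + 1) (i := 1) (j := j) (Or.inl (by omega))]
  | succ i ih =>
    induction j with
    | zero => simp [part_eq_zero he (k := k + 1) (j := 1) (i := i + 1) (Or.inr (by omega))]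
    | succ j ihj =>
      have h1 := part_succ_succ (e := e) k (i + 1) j
      have h2 := part_succ_succ (e := e) k i (j + 1)
      have h3 := ihj.1
      have h3' := ihj.2
      have h4 := (ih (j + 1)).1
      have h5 := (ih (j + 1)).2
      omega

theorem part_transpose (k i j : ℕ) : part (fun i j => e j i) k i j = part e k j i := by
  have h : bumped^[k] (fun i j => e j i) = fun i j => bumped^[k] e j i := by
    induction k with
    | zero => rfl
    | succ k ih => rw [Function.iterate_succ_apply', Function.iterate_succ_apply', ih,
        bumped_transpose]
  rw [part, h, lpp_transpose, part]

theorem total_eq_sum_part (he : ∀ i j, 0 ≤ e i j) (n : ℕ) : total n e = ∑ k ∈ Finset.range n, part e k n n := by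
  have h : ∀ m, total n e = ∑ k ∈ Finset.range m, part e k n n + total n (bumped^[m] e) := by
    intro m
    induction m with
    | zero => simp
    | succ m ih =>
      rw [Finset.sum_range_succ, Function.iterate_succ_apply', total_bumped, ih, part]
      ring
  rw [h n, add_eq_left]
  exact Finset.sum_eq_zero fun i hi => Finset.sum_eq_zero fun j _ =>
    iterate_bumped_eq_zero he n i j (Or.inl (Finset.mem_range.1 hi))

end part

/-! ### The correspondence between matrices and plane partitions -/

/-- Plane partitions in an `n × n` square, extended by zero. -/
structure IsPlanePartition (n : ℕ) (ρ : ℕ → ℕ → ℤ) : Prop where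
  nonneg : ∀ i j, 0 ≤ ρ i j
  zero : ∀ i j, n ≤ i ∨ n ≤ j → ρ i j = 0
  anti_left : ∀ i j, ρ (i + 1) j ≤ ρ i j
  anti_right : ∀ i j, ρ i (j + 1) ≤ ρ i j

/-- The pair of tableaux of `e`, glued along their common shape: the diagonals of `toPlanePartition n e`
on and above the main one are the partitions of the growth diagram along the edge `i = n`, those on
and below it the partitions along the edge `j = n`. (Truncated subtraction selects the edge.) -/
def toPlanePartition (n : ℕ) (e : ℕ → ℕ → ℤ) (i j : ℕ) : ℤ :=
  part e (min i j) (n - (i - j)) (n - (j - i))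

/-- The growth diagram run backwards from the edges recorded in `ρ`; `reverseGrowth ρ a b k` is the
`k`-th part of the partition that sits `a` rows and `b` columns before the far corner. -/
def reverseGrowth (ρ : ℕ → ℕ → ℤ) : ℕ → ℕ → ℕ → ℤ
  | 0, b => fun k => ρ k (k + b)
  | a + 1, 0 => fun k => ρ (k + (a + 1)) k
  | a + 1, b + 1 => fun k =>
      max (reverseGrowth ρ (a + 1) b (k + 1)) (reverseGrowth ρ a (b + 1) (k + 1))
        + min (reverseGrowth ρ (a + 1) b k) (reverseGrowth ρ a (b + 1) k)
        - reverseGrowth ρ a b (k + 1)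

section reverseGrowth

variable {ρ : ℕ → ℕ → ℤ} {n : ℕ}

theorem reverseGrowth_zero_left (b k : ℕ) : reverseGrowth ρ 0 b k = ρ k (k + b) := by
  simp [reverseGrowth]

theorem reverseGrowth_zero_right (a k : ℕ) : reverseGrowth ρ a 0 k = ρ (k + a) k := by
  cases a <;> simp [reverseGrowth]

theorem reverseGrowth_succ (a b k : ℕ) : reverseGrowth ρ (a + 1) (b + 1) k =
    max (reverseGrowth ρ (a + 1) b (k + 1)) (reverseGrowth ρ a (b + 1) (k + 1))
        + min (reverseGrowth ρ (a + 1) b k) (reverseGrowth ρ a (b + 1) k)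
        - reverseGrowth ρ a b (k + 1) := by
  simp [reverseGrowth]

theorem IsPlanePartition.reverseGrowth_interlace (h : IsPlanePartition n ρ) (a b k : ℕ) :
    (reverseGrowth ρ (a + 1) b k ≤ reverseGrowth ρ a b k ∧
      reverseGrowth ρ a b (k + 1) ≤ reverseGrowth ρ (a + 1) b k) ∧
    (reverseGrowth ρ a (b + 1) k ≤ reverseGrowth ρ a b k ∧
      reverseGrowth ρ a b (k + 1) ≤ reverseGrowth ρ a (b + 1) k) := by
  have hl0 : ∀ a k, reverseGrowth ρ (a + 1) 0 k ≤ reverseGrowth ρ a 0 k ∧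
      reverseGrowth ρ a 0 (k + 1) ≤ reverseGrowth ρ (a + 1) 0 k := by
    intro a k
    simp only [reverseGrowth_zero_right]
    refine ⟨h.anti_left _ _, ?_⟩
    have := h.anti_right (k + 1 + a) k
    rwa [show k + 1 + a = k + (a + 1) by ring] at this ⊢
  have hr0 : ∀ b k, reverseGrowth ρ 0 (b + 1) k ≤ reverseGrowth ρ 0 b k ∧
      reverseGrowth ρ 0 b (k + 1) ≤ reverseGrowth ρ 0 (b + 1) k := by
    intro b k
    simp only [reverseGrowth_zero_left]
    refine ⟨h.anti_right _ _, ?_⟩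
    have := h.anti_left k (k + 1 + b)
    rwa [show k + 1 + b = k + (b + 1) by ring] at this ⊢
  -- At the corner `(a + 1, b + 1)` both claims follow from those at its two neighbours.
  have step : ∀ a b, (∀ k, reverseGrowth ρ (a + 1) b k ≤ reverseGrowth ρ a b k ∧
      reverseGrowth ρ a b (k + 1) ≤ reverseGrowth ρ (a + 1) b k) →
      (∀ k, reverseGrowth ρ a (b + 1) k ≤ reverseGrowth ρ a b k ∧
      reverseGrowth ρ a b (k + 1) ≤ reverseGrowth ρ a (b + 1) k) → ∀ k,
      (reverseGrowth ρ (a + 1) (b + 1) k ≤ reverseGrowth ρ a (b + 1) k ∧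
      reverseGrowth ρ a (b + 1) (k + 1) ≤ reverseGrowth ρ (a + 1) (b + 1) k) ∧
      (reverseGrowth ρ (a + 1) (b + 1) k ≤ reverseGrowth ρ (a + 1) b k ∧
      reverseGrowth ρ (a + 1) b (k + 1) ≤ reverseGrowth ρ (a + 1) (b + 1) k) := by
    intro a b h1 h2 k
    have h3 := reverseGrowth_succ (ρ := ρ) a b k
    have h4 := h1 k
    have h5 := h2 k
    have h6 := h1 (k + 1)
    have h7 := h2 (k + 1)
    omega
  have hrow : ∀ a, (∀ b k, reverseGrowth ρ a (b + 1) k ≤ reverseGrowth ρ a b k ∧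
      reverseGrowth ρ a b (k + 1) ≤ reverseGrowth ρ a (b + 1) k) →
      ∀ b k, reverseGrowth ρ (a + 1) b k ≤ reverseGrowth ρ a b k ∧
      reverseGrowth ρ a b (k + 1) ≤ reverseGrowth ρ (a + 1) b k := by
    intro a ha b
    induction b with
    | zero => exact hl0 a
    | succ b ih => exact fun k => (step a b ih (ha b) k).1
  have hr : ∀ a b k, reverseGrowth ρ a (b + 1) k ≤ reverseGrowth ρ a b k ∧
      reverseGrowth ρ a b (k + 1) ≤ reverseGrowth ρ a (b + 1) k := by
    intro a
    induction a with
    | zero => exact hr0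
    | succ a ih => exact fun b k => (step a b (hrow a ih b) (ih b) k).2
  exact ⟨hrow a (hr a) b k, hr a b k⟩

theorem IsPlanePartition.reverseGrowth_nonneg (h : IsPlanePartition n ρ) (a b k : ℕ) :
    0 ≤ reverseGrowth ρ a b k := by
  induction a generalizing k with
  | zero => rw [reverseGrowth_zero_left]; exact h.nonneg _ _
  | succ a ih => exact (ih (k + 1)).trans (h.reverseGrowth_interlace a b k).1.2

theorem IsPlanePartition.reverseGrowth_eq_zero (h : IsPlanePartition n ρ) (a b k : ℕ)
    (hk : n ≤ k + a ∨ n ≤ k + b) : reverseGrowth ρ a b k = 0 := by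
  induction a generalizing b k with
  | zero => rw [reverseGrowth_zero_left]; exact h.zero _ _ (by omega)
  | succ a ih =>
    induction b generalizing k with
    | zero => rw [reverseGrowth_zero_right]; exact h.zero _ _ (by omega)
    | succ b ihb =>
      rw [reverseGrowth_succ, ihb (k + 1) (by omega), ih (b + 1) (k + 1) (by omega),
        ih b (k + 1) (by omega)]
      have h1 := h.reverseGrowth_nonneg (a + 1) b k
      have h2 := h.reverseGrowth_nonneg a (b + 1) k
      rcases hk with hk | hk
      · rw [ihb k (by omega)]; simpa using h2
      · rw [ih (b + 1) k (by omega)]; simpa using h1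

end reverseGrowth

section correspondence

variable {n : ℕ} {e e' : ℕ → ℕ → ℤ}

theorem toPlanePartition_transpose (i j : ℕ) :
    toPlanePartition n (fun i j => e j i) i j = toPlanePartition n e j i := by
  rw [toPlanePartition, part_transpose, toPlanePartition, min_comm]

theorem toPlanePartition_zero_zero : toPlanePartition n e 0 0 = lpp e n n := by
  simp [toPlanePartition, part_zero]

theorem sum_toPlanePartition_diag (he : ∀ i j, 0 ≤ e i j) :
    ∑ i ∈ Finset.range n, toPlanePartition n e i i = total n e := by
  rw [total_eq_sum_part he]
  simp [toPlanePartition]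

theorem part_eq_reverseGrowth {a b : ℕ} (ha : a ≤ n) (hb : b ≤ n) (k : ℕ) :
    part e k (n - a) (n - b) = reverseGrowth (toPlanePartition n e) a b k := by
  induction a generalizing b k with
  | zero => rw [reverseGrowth_zero_left, toPlanePartition]; congr 1 <;> omega
  | succ a ih =>
    induction b generalizing k with
    | zero => rw [reverseGrowth_zero_right, toPlanePartition]; congr 1 <;> omega
    | succ b ihb =>
      rw [reverseGrowth_succ, ← ihb (by omega), ← ihb (by omega), ← ih (by omega) hb,
        ← ih (by omega) hb, ← ih (by omega) (by omega)]
      obtain ⟨i, hi⟩ : ∃ i, n - a = i + 1 := ⟨n - a - 1, by omega⟩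
      obtain ⟨j, hj⟩ : ∃ j, n - b = j + 1 := ⟨n - b - 1, by omega⟩
      rw [hi, hj, show n - (a + 1) = i by omega, show n - (b + 1) = j by omega, part_succ_succ]
      ring

theorem isPlanePartition_toPlanePartition (he : IsWeightMatrix n e) :
    IsPlanePartition n (toPlanePartition n e) where
  nonneg i j := part_nonneg he.nonneg _ _ _
  zero i j h := part_eq_zero he.nonneg (by omega)
  anti_left i j := by
    simp only [toPlanePartition]
    rcases le_or_gt j i with h | h
    · rw [min_eq_right (by omega), min_eq_right h, show n - (j - (i + 1)) = n by omega,
        show n - (j - i) = n by omega]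
      rcases le_or_gt n (i - j) with h' | h'
      · rw [show n - (i + 1 - j) = n - (i - j) by omega]
      · rw [show n - (i - j) = n - (i + 1 - j) + 1 by omega]
        exact part_le_left he.nonneg _ _ _
    · rw [min_eq_left (by omega), min_eq_left h.le, show n - (i - j) = n by omega,
        show n - (i + 1 - j) = n by omega]
      rcases lt_or_ge n (j - i) with h' | h'
      · rw [part_eq_zero he.nonneg (by omega)]; exact part_nonneg he.nonneg _ _ _
      · rw [show n - (j - (i + 1)) = n - (j - i) + 1 by omega]
        exact (part_interlace he.nonneg _ _ _).2
  anti_right i j := by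
    simp only [toPlanePartition]
    rcases le_or_gt i j with h | h
    · rw [min_eq_left (by omega), min_eq_left h, show n - (i - (j + 1)) = n by omega,
        show n - (i - j) = n by omega]
      rcases le_or_gt n (j - i) with h' | h'
      · rw [show n - (j + 1 - i) = n - (j - i) by omega]
      · rw [show n - (j - i) = n - (j + 1 - i) + 1 by omega]
        exact part_le_right he.nonneg _ _ _
    · rw [min_eq_right (by omega), min_eq_right h.le, show n - (j - i) = n by omega,
        show n - (j + 1 - i) = n by omega]
      rcases lt_or_ge n (i - j) with h' | h'
      · rw [part_eq_zero he.nonneg (by omega)]; exact part_nonneg he.nonneg _ _ _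
      · rw [show n - (i - (j + 1)) = n - (i - j) + 1 by omega]
        exact (part_interlace he.nonneg _ _ _).1

theorem toPlanePartition_injOn : Set.InjOn (toPlanePartition n) {e | IsWeightMatrix n e} := by
  intro e he e' he' h
  have hp : ∀ i ≤ n, ∀ j ≤ n, part e 0 i j = part e' 0 i j := by
    intro i hi j hj
    have h1 := part_eq_reverseGrowth (e := e) (n := n) (a := n - i) (b := n - j)
      (by omega) (by omega) 0
    rw [h, ← part_eq_reverseGrowth (by omega) (by omega)] at h1
    rwa [show n - (n - i) = i by omega, show n - (n - j) = j by omega] at h1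
  funext i j
  rcases lt_or_ge i n with hi | hi
  · rcases lt_or_ge j n with hj | hj
    · have h1 := part_zero_succ (e := e) i j
      have h2 := part_zero_succ (e := e') i j
      rw [hp i (by omega) (j + 1) (by omega), hp (i + 1) (by omega) j (by omega),
        hp (i + 1) (by omega) (j + 1) (by omega)] at h1
      omega
    · rw [he.zero _ _ (Or.inr hj), he'.zero _ _ (Or.inr hj)]
  · rw [he.zero _ _ (Or.inl hi), he'.zero _ _ (Or.inl hi)]

/-- The weights at the end of the growth diagram run backwards from `ρ`. -/
def ofPlanePartition (n : ℕ) (ρ : ℕ → ℕ → ℤ) (i j : ℕ) : ℤ :=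
  if i < n ∧ j < n then
    reverseGrowth ρ (n - (i + 1)) (n - (j + 1)) 0 -
      max (reverseGrowth ρ (n - i) (n - (j + 1)) 0) (reverseGrowth ρ (n - (i + 1)) (n - j) 0)
  else 0

theorem IsPlanePartition.isWeightMatrix {ρ : ℕ → ℕ → ℤ} (h : IsPlanePartition n ρ) :
    IsWeightMatrix n (ofPlanePartition n ρ) where
  nonneg i j := by
    rw [ofPlanePartition]
    split_ifs with hij
    · rw [show n - i = n - (i + 1) + 1 by omega, show n - j = n - (j + 1) + 1 by omega]
      have := h.reverseGrowth_interlace (n - (i + 1)) (n - (j + 1)) 0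
      omega
    · exact le_rfl
  zero i j hij := by
    rw [ofPlanePartition, if_neg (by omega)]

theorem IsPlanePartition.part_ofPlanePartition {ρ : ℕ → ℕ → ℤ} (h : IsPlanePartition n ρ) :
    ∀ i ≤ n, ∀ j ≤ n, ∀ k,
      part (ofPlanePartition n ρ) k i j = reverseGrowth ρ (n - i) (n - j) k := by
  intro i
  induction i with
  | zero =>
    intro _ j _ k
    rw [part_zero_left, h.reverseGrowth_eq_zero _ _ _ (by omega)]
  | succ i ih =>
    intro hi j
    induction j with
    | zero =>
      intro _ k
      rw [part_zero_right, h.reverseGrowth_eq_zero _ _ _ (by omega)]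
    | succ j ihj =>
      intro hj k
      cases k with
      | zero =>
        rw [part_zero_succ, ih (by omega) _ hj, ihj (by omega), ofPlanePartition,
          if_pos ⟨by omega, by omega⟩]
        ring
      | succ k =>
        rw [part_succ_succ, ih (by omega) _ hj, ihj (by omega), ih (by omega) _ hj,
          ihj (by omega), ih (by omega) _ (by omega)]
        have := reverseGrowth_succ (ρ := ρ) (n - (i + 1)) (n - (j + 1)) k
        rw [show n - (i + 1) + 1 = n - i by omega, show n - (j + 1) + 1 = n - j by omega] at this
        omega

theorem IsPlanePartition.toPlanePartition_ofPlanePartition {ρ : ℕ → ℕ → ℤ}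
    (h : IsPlanePartition n ρ) : toPlanePartition n (ofPlanePartition n ρ) = ρ := by
  funext i j
  by_cases hij : n ≤ i ∨ n ≤ j
  · rw [h.zero _ _ hij, (isPlanePartition_toPlanePartition h.isWeightMatrix).zero _ _ hij]
  · rw [toPlanePartition, h.part_ofPlanePartition _ (by omega) _ (by omega),
      show n - (n - (i - j)) = i - j by omega, show n - (n - (j - i)) = j - i by omega]
    rcases le_total i j with h' | h'
    · rw [min_eq_left h', Nat.sub_eq_zero_of_le h', reverseGrowth_zero_left]
      congr 1; omega
    · rw [min_eq_right h', Nat.sub_eq_zero_of_le h', reverseGrowth_zero_right]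
      congr 1; omega

/-- The Robinson–Schensted–Knuth correspondence. With `symm := True` it is the restriction to
symmetric matrices, with `symm := False` no symmetry is imposed. -/
theorem bijOn_toPlanePartition (n : ℕ) (symm : Prop) : Set.BijOn (toPlanePartition n)
    {e | IsWeightMatrix n e ∧ (symm → ∀ i j, e i j = e j i)}
    {ρ | IsPlanePartition n ρ ∧ (symm → ∀ i j, ρ i j = ρ j i)} := by
  refine ⟨?_, toPlanePartition_injOn.mono fun e he => he.1, ?_⟩
  · rintro e ⟨he, hs⟩
    refine ⟨isPlanePartition_toPlanePartition he, fun h i j => ?_⟩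
    rw [← toPlanePartition_transpose]
    congr 1
    funext i j
    exact hs h j i
  · rintro ρ ⟨hρ, hs⟩
    refine ⟨ofPlanePartition n ρ, ⟨hρ.isWeightMatrix, fun h i j => ?_⟩,
      hρ.toPlanePartition_ofPlanePartition⟩
    have ht : IsWeightMatrix n fun i j => ofPlanePartition n ρ j i :=
      ⟨fun i j => hρ.isWeightMatrix.nonneg j i, fun i j hij => hρ.isWeightMatrix.zero j i hij.symm⟩
    refine congrFun (congrFun (toPlanePartition_injOn hρ.isWeightMatrix ht ?_) i) j
    funext i j
    have hij := toPlanePartition_transpose (n := n) (e := ofPlanePartition n ρ) i j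
    rw [hij, hρ.toPlanePartition_ofPlanePartition, hs h]

end correspondence

/-! ### Row insertion and passage times through two rows -/

/-- A row of non-negative weights in columns `0, …, n - 1`, given by its partial sums. -/
structure IsRow (n : ℕ) (R : ℕ → ℤ) : Prop where
  zero : R 0 = 0
  mono : ∀ j, R j ≤ R (j + 1)
  const : ∀ j, n ≤ j → R (j + 1) = R j

/-- Insertion of the row `A` into the row `X` of a tableau (both given by partial sums). -/
def insertRow (X A : ℕ → ℤ) : ℕ → ℤ
  | 0 => 0
  | j + 1 => max (X (j + 1)) (insertRow X A j) + A (j + 1) - A j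

/-- The row of entries bumped out by the insertion of `A` into `X`. -/
def bumpedRow (X A : ℕ → ℤ) (j : ℕ) : ℤ := X j + A j - insertRow X A j

section Row

variable {n : ℕ} {X A U : ℕ → ℤ}

theorem IsRow.monotone (h : IsRow n X) : Monotone X := monotone_nat_of_le_succ h.mono

theorem IsRow.nonneg (h : IsRow n X) (j : ℕ) : 0 ≤ X j := h.zero ▸ h.monotone (Nat.zero_le j)

theorem IsRow.ext (hX : IsRow n X) (hA : IsRow n A) (h : ∀ j ≤ n, X j = A j) : X = A := by
  funext j
  induction j with
  | zero => exact h 0 (Nat.zero_le n)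
  | succ j ih =>
    rcases lt_or_ge j n with hj | hj
    · exact h _ hj
    · rw [hX.const j hj, hA.const j hj, ih]

theorem isRow_zero : IsRow n 0 := ⟨rfl, fun _ => le_rfl, fun _ _ => rfl⟩

@[simp] theorem insertRow_zero : insertRow X A 0 = 0 := by simp [insertRow]

theorem insertRow_succ (j : ℕ) :
    insertRow X A (j + 1) = max (X (j + 1)) (insertRow X A j) + A (j + 1) - A j := by
  simp [insertRow]

theorem bumpedRow_succ (j : ℕ) :
    bumpedRow X A (j + 1) = min (X (j + 1)) (insertRow X A j) - insertRow X A j + A j := by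
  rw [bumpedRow, insertRow_succ]
  omega

theorem bumpedRow_add_insertRow (j : ℕ) : bumpedRow X A j + insertRow X A j = X j + A j := by
  rw [bumpedRow]; ring

theorem le_insertRow (hX : IsRow n X) (hA : IsRow n A) (j : ℕ) : X j ≤ insertRow X A j := by
  cases j with
  | zero => simp [hX.zero]
  | succ j => have := hA.mono j; rw [insertRow_succ]; omega

theorem le_insertRow_right (hA : IsRow n A) (j : ℕ) : A j ≤ insertRow X A j := by
  induction j with
  | zero => simp [hA.zero]
  | succ j ih => rw [insertRow_succ]; omega

theorem isRow_insertRow (hX : IsRow n X) (hA : IsRow n A) : IsRow n (insertRow X A) where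
  zero := insertRow_zero
  mono j := by have := hA.mono j; rw [insertRow_succ]; omega
  const j hj := by
    have h1 := hX.const j hj
    have h2 := hA.const j hj
    have h3 := le_insertRow hX hA j
    rw [insertRow_succ]
    omega

theorem isRow_bumpedRow (hX : IsRow n X) (hA : IsRow n A) : IsRow n (bumpedRow X A) where
  zero := by simp [bumpedRow, hX.zero, hA.zero]
  mono j := by
    have h1 := hX.mono j
    have h3 := le_insertRow hX hA j
    rw [bumpedRow_succ, bumpedRow]
    omega
  const j hj := by
    have h1 := hX.const j hj
    have h3 := le_insertRow hX hA j
    rw [bumpedRow_succ, bumpedRow]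
    omega

/-- The passage time through the rows `U` (first) and `A` (second), from column `c` to column
`d - 1`, is at most `t`: a path uses column `i` in both rows. -/
def PairLE (U A : ℕ → ℤ) (c d : ℕ) (t : ℤ) : Prop :=
  ∀ i, c ≤ i → i < d → U (i + 1) - U c + A d - A i ≤ t

/-- The complementary statistic of two rows: every dual path, which takes `A` before column `i`
and `U` after it, has weight at least `t`. -/
def PairGE (U A : ℕ → ℤ) (c d : ℕ) (t : ℤ) : Prop :=
  ∀ i, c ≤ i → i < d → t ≤ A i - A c + U d - U (i + 1)

/-- Two pairs of rows are equivalent if they have the same passage times between any two columns. -/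
def PairEquiv (n : ℕ) (U A U' A' : ℕ → ℤ) : Prop :=
  ∀ c d t, c < d → d ≤ n → (PairLE U A c d t ↔ PairLE U' A' c d t)

theorem pairGE_iff_pairLE (c d : ℕ) (t : ℤ) :
    PairGE U A c d t ↔ PairLE U A c d (U d - U c + (A d - A c) - t) := by
  refine forall_congr' fun i => forall_congr' fun _ => forall_congr' fun _ => ?_
  constructor <;> intro h <;> omega

theorem pairLE_iff_pairGE (c d : ℕ) (t : ℤ) :
    PairLE U A c d t ↔ PairGE U A c d (U d - U c + (A d - A c) - t) := by
  rw [pairGE_iff_pairLE, sub_sub_cancel]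

/-- For a sequence `f` with running maximum `F`, Pitman's transform has the same maximum over an
interval as `f` itself, up to the values of `F` at its ends. -/
theorem runningMax_transform_le_iff {f F : ℕ → ℤ} (hF : ∀ i, F (i + 1) = max (f i) (F i))
    {c d : ℕ} (hcd : c < d) (t : ℤ) :
    (∀ i, c ≤ i → i < d → f i ≤ t) ↔
      ∀ i, c ≤ i → i < d → min (f i) (F i) - 2 * F i + F c + F d ≤ t := by
  have hmono : Monotone F := monotone_nat_of_le_succ fun i => by rw [hF]; exact le_max_right _ _
  constructor
  · intro h i hi hid
    have hd : ∀ e, c ≤ e → e ≤ d → F e ≤ max (F c) t := by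
      intro e he
      induction e, he using Nat.le_induction with
      | base => intro _; exact le_max_left _ _
      | succ e he ih =>
        intro hed
        have h1 := ih (by omega)
        have h2 := h e he (by omega)
        have h3 := hF e
        omega
    have h1 := hd d hcd.le le_rfl
    have h2 := hmono hi
    have h3 := hmono hid.le
    have h4 := h i hi hid
    omega
  · intro h
    rcases (hmono hcd.le).eq_or_lt with heq | hlt
    · intro i hi hid
      have h1 := h i hi hid
      have h2 := hmono hi
      have h3 : F (i + 1) ≤ F d := hmono hid
      have h4 := hF i
      omega
    · -- The first record after `c` forces `F d ≤ t`.
      have hrec : ∀ e, c ≤ e → F c < F e → ∃ i, c ≤ i ∧ i < e ∧ F i = F c ∧ F c < F (i + 1) := by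
        intro e he
        induction e, he using Nat.le_induction with
        | base => intro h; exact absurd h (lt_irrefl _)
        | succ e he ih =>
          intro hlt
          rcases (hmono he).eq_or_lt with h' | h'
          · exact ⟨e, he, by omega, h'.symm, hlt⟩
          · obtain ⟨i, h1, h2, h3⟩ := ih h'
            exact ⟨i, h1, by omega, h3⟩
      obtain ⟨k, h1, h2, h3, h4⟩ := hrec d hcd.le hlt
      have h5 := h k h1 h2
      have h6 := hF k
      intro i hi hid
      have h7 : F (i + 1) ≤ F d := hmono hid
      have h8 := hF i
      omega

/-- Row insertion preserves all passage times through the two rows. -/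
theorem pairLE_bumpedRow_insertRow {c d : ℕ}
    (hcd : c < d) (t : ℤ) :
    PairLE X A c d t ↔ PairLE (bumpedRow X A) (insertRow X A) c d t := by
  have h := runningMax_transform_le_iff (f := fun i => X (i + 1) - A i)
    (F := fun i => insertRow X A i - A i) (fun i => by rw [insertRow_succ]; omega) hcd
    (t - A d + X c)
  have h1 : PairLE X A c d t ↔ ∀ i, c ≤ i → i < d → X (i + 1) - A i ≤ t - A d + X c := by
    refine forall_congr' fun i => forall_congr' fun _ => forall_congr' fun _ => ?_
    constructor <;> intro h <;> omega
  rw [h1, h]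
  refine forall_congr' fun i => forall_congr' fun _ => forall_congr' fun _ => ?_
  rw [bumpedRow_succ, bumpedRow]
  constructor <;> intro h <;> omega

theorem pairEquiv_bumpedRow_insertRow :
    PairEquiv n X A (bumpedRow X A) (insertRow X A) :=
  fun _ _ t hcd _ => pairLE_bumpedRow_insertRow hcd t

theorem pairGE_bumpedRow_insertRow (c d : ℕ) (t : ℤ) :
    PairGE X A c d t ↔ PairGE (bumpedRow X A) (insertRow X A) c d t := by
  rcases lt_or_ge c d with hcd | hcd
  · rw [pairGE_iff_pairLE, pairGE_iff_pairLE, pairLE_bumpedRow_insertRow hcd]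
    have h1 := bumpedRow_add_insertRow (X := X) (A := A) c
    have h2 := bumpedRow_add_insertRow (X := X) (A := A) d
    rw [show X d - X c + (A d - A c) - t = bumpedRow X A d - bumpedRow X A c +
      (insertRow X A d - insertRow X A c) - t by omega]
  · constructor <;> intro _ i hi hid <;> omega

/-- The first row of the tableau records the passage times from column `0`. -/
theorem insertRow_le_iff (hX : IsRow n X) (hA : IsRow n A) {d : ℕ} (hd : 1 ≤ d) (t : ℤ) :
    insertRow X A d ≤ t ↔ PairLE X A 0 d t := by
  induction d, hd using Nat.le_induction generalizing t with
  | base =>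
    have h0 := hX.zero
    have h1 := hX.mono 0
    have h2 := hA.zero
    rw [insertRow_succ, insertRow_zero]
    simp only [zero_add] at h1 ⊢
    constructor
    · intro h i _ hi
      obtain rfl : i = 0 := by omega
      simp only [zero_add]
      omega
    · intro h
      have := h 0 le_rfl one_pos
      simp only [zero_add] at this
      omega
  | succ d hd ih =>
    have h0 := hX.zero
    have h1 := ih (t - A (d + 1) + A d)
    rw [insertRow_succ]
    constructor
    · intro h i _ hi
      rcases Nat.lt_succ_iff_lt_or_eq.1 hi with hi | rfl
      · have := h1.1 (by omega) i (Nat.zero_le i) hi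
        omega
      · omega
    · intro h
      have h2 := h d (Nat.zero_le d) (by omega)
      have h3 := h1.2 fun i hi hid => by
        have := h i hi (by omega)
        omega
      omega

theorem PairEquiv.symm {U' A' : ℕ → ℤ} (h : PairEquiv n U A U' A') : PairEquiv n U' A' U A :=
  fun c d t hcd hd => (h c d t hcd hd).symm

theorem PairEquiv.trans {U' A' U'' A'' : ℕ → ℤ} (h : PairEquiv n U A U' A')
    (h' : PairEquiv n U' A' U'' A'') : PairEquiv n U A U'' A'' :=
  fun c d t hcd hd => (h c d t hcd hd).trans (h' c d t hcd hd)

theorem PairEquiv.add_eq {U' A' : ℕ → ℤ} (h : PairEquiv n U A U' A') (hU : IsRow n U)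
    (hA : IsRow n A) (hU' : IsRow n U') (hA' : IsRow n A') :
    ∀ d ≤ n, U d + A d = U' d + A' d := by
  intro d
  induction d with
  | zero => intro _; rw [hU.zero, hA.zero, hU'.zero, hA'.zero]
  | succ d ih =>
    intro hd
    have h0 := ih (by omega)
    have key : ∀ (V B : ℕ → ℤ) (t : ℤ),
        PairLE V B d (d + 1) t ↔ V (d + 1) - V d + B (d + 1) - B d ≤ t := by
      intro V B t
      refine ⟨fun h => h d le_rfl (by omega), fun h i hi hid => ?_⟩
      obtain rfl : i = d := by omega
      exact h
    have h1 := (key U' A' _).1 ((h d (d + 1) _ (by omega) hd).1 ((key U A _).2 le_rfl))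
    have h2 := (key U A _).1 ((h d (d + 1) _ (by omega) hd).2 ((key U' A' _).2 le_rfl))
    omega

theorem PairEquiv.pairGE_iff {U' A' : ℕ → ℤ} (h : PairEquiv n U A U' A') (hU : IsRow n U)
    (hA : IsRow n A) (hU' : IsRow n U') (hA' : IsRow n A') {c d : ℕ} (hd : d ≤ n) (t : ℤ) :
    PairGE U A c d t ↔ PairGE U' A' c d t := by
  rcases lt_or_ge c d with hcd | hcd
  · have h1 := h.add_eq hU hA hU' hA' d hd
    have h2 := h.add_eq hU hA hU' hA' c (by omega)
    rw [pairGE_iff_pairLE, pairGE_iff_pairLE, h c d _ hcd hd]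
    rw [show U d - U c + (A d - A c) - t = U' d - U' c + (A' d - A' c) - t by omega]
  · constructor <;> intro _ i hi hid <;> omega

/-- The dual statistic of three rows: every dual path, which takes `A`, then `U`, then `X` and
omits two columns, has weight at least `t`. -/
def TripleGE (X U A : ℕ → ℤ) (d : ℕ) (t : ℤ) : Prop :=
  ∀ i l, i < l → l < d → t ≤ A i + U l - U (i + 1) + X d - X (l + 1)

theorem tripleGE_iff_fst (hA : IsRow n A) (d : ℕ) (t : ℤ) :
    TripleGE X U A d t ↔ ∀ l < d, PairGE U A 0 l (t - X d + X (l + 1)) := by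
  have h0 := hA.zero
  constructor
  · intro h l hl i _ hi
    have := h i l hi hl
    omega
  · intro h i l hi hl
    have := h l hl i (Nat.zero_le i) hi
    omega

theorem tripleGE_iff_snd (d : ℕ) (t : ℤ) :
    TripleGE X U A d t ↔ ∀ i < d, PairGE X U (i + 1) d (t - A i) := by
  constructor
  · intro h i _ l hl hld
    have := h i l hl hld
    omega
  · intro h i l hi hl
    have := h i (by omega) l hi hl
    omega

/-- The dual statistic of three rows is preserved by inserting the last two rows in the first. -/
theorem tripleGE_iff_pairGE (hX : IsRow n X) (hU : IsRow n U) (hA : IsRow n A) {d : ℕ}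
    (hd : 2 ≤ d) (t : ℤ) :
    TripleGE X U A d t ↔
      PairGE (bumpedRow X U) (bumpedRow (insertRow X U) A) 0 d t := by
  have hX' := isRow_insertRow hX hU
  have hU' := isRow_bumpedRow hX hU
  have hX'' := isRow_insertRow hX' hA
  have hA' := isRow_bumpedRow hX' hA
  have h1 : TripleGE X U A d t ↔ TripleGE (bumpedRow X U) (bumpedRow (insertRow X U) A)
      (insertRow (insertRow X U) A) d t := by
    rw [tripleGE_iff_snd]
    simp only [pairGE_bumpedRow_insertRow (X := X) (A := U)]
    rw [← tripleGE_iff_snd, tripleGE_iff_fst hA]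
    simp only [pairGE_bumpedRow_insertRow (X := insertRow X U) (A := A)]
    rw [← tripleGE_iff_fst hX'']
  rw [h1]
  have hu : bumpedRow X U 1 = 0 := by
    have := hX.nonneg 1
    have h0 := hU.zero
    rw [show (1 : ℕ) = 0 + 1 from rfl, bumpedRow_succ, insertRow_zero]
    simp only [zero_add]
    omega
  have ha : bumpedRow (insertRow X U) A 1 = 0 := by
    have := hX'.nonneg 1
    have h0 := hA.zero
    rw [show (1 : ℕ) = 0 + 1 from rfl, bumpedRow_succ, insertRow_zero]
    simp only [zero_add]
    omega
  have hle : ∀ i, bumpedRow (insertRow X U) A (i + 1) ≤ insertRow (insertRow X U) A i := by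
    intro i
    have := le_insertRow_right (X := insertRow X U) hA i
    rw [bumpedRow_succ]
    omega
  have ha0 := hA'.zero
  constructor
  · intro h i _ hi
    rcases Nat.eq_zero_or_pos i with rfl | hi0
    · have h2 := h 0 1 one_pos (by omega)
      have h3 := hU'.mono 1
      rw [insertRow_zero] at h2
      simp only [zero_add] at h2 ⊢
      omega
    · have h2 := h 0 i hi0 hi
      rw [insertRow_zero] at h2
      simp only [zero_add] at h2
      omega
  · intro h i l hi hl
    have h2 := h l (Nat.zero_le l) hl
    have h3 := hle i
    omega

/-- Equivalent pairs of rows, inserted in the same row, give the same row and bump out equivalent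
pairs of rows. -/
theorem PairEquiv.insert {U' A' : ℕ → ℤ} (h : PairEquiv n U A U' A') (hX : IsRow n X)
    (hU : IsRow n U) (hA : IsRow n A) (hU' : IsRow n U') (hA' : IsRow n A') :
    insertRow (insertRow X U) A = insertRow (insertRow X U') A' ∧
      PairEquiv n (bumpedRow X U) (bumpedRow (insertRow X U) A)
        (bumpedRow X U') (bumpedRow (insertRow X U') A') := by
  have hXU := isRow_insertRow hX hU
  have hXU' := isRow_insertRow hX hU'
  have hb := isRow_bumpedRow hX hU
  have hb' := isRow_bumpedRow hX hU'
  have hc := isRow_bumpedRow hXU hA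
  have hc' := isRow_bumpedRow hXU' hA'
  have hX0 := hX.zero
  have key : ∀ {V B : ℕ → ℤ}, IsRow n V → IsRow n B → ∀ {d : ℕ}, 0 < d → ∀ t,
      insertRow (insertRow X V) B d ≤ t ↔ ∀ i < d, PairLE V B i d (t - X (i + 1)) := by
    intro V B hV hB d hd t
    rw [insertRow_le_iff (isRow_insertRow hX hV) hB hd]
    constructor
    · intro h i hi l hil hl
      have h1 := (insertRow_le_iff hX hV (Nat.succ_pos l) (t - B d + B l)).1 (by
        have := h l (Nat.zero_le l) hl
        rw [insertRow_zero] at this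
        simp only [Nat.succ_eq_add_one]
        omega) i (Nat.zero_le i) (by omega)
      simp only [Nat.succ_eq_add_one] at h1
      omega
    · intro h l _ hl
      have h1 := (insertRow_le_iff hX hV (Nat.succ_pos l) (t - B d + B l)).2 (by
        intro i _ hi
        have := h i (by omega) l (by omega) hl
        simp only [Nat.succ_eq_add_one]
        omega)
      rw [insertRow_zero]
      simp only [Nat.succ_eq_add_one] at h1
      omega
  have heq : ∀ d ≤ n, insertRow (insertRow X U) A d = insertRow (insertRow X U') A' d := by
    intro d hd
    rcases Nat.eq_zero_or_pos d with rfl | hd0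
    · simp
    · have : ∀ t, insertRow (insertRow X U) A d ≤ t ↔ insertRow (insertRow X U') A' d ≤ t := by
        intro t
        rw [key hU hA hd0, key hU' hA' hd0]
        exact forall_congr' fun i => forall_congr' fun hi => h i d _ hi hd
      exact le_antisymm ((this _).2 le_rfl) ((this _).1 le_rfl)
  have hrow := (isRow_insertRow hXU hA).ext (isRow_insertRow hXU' hA') heq
  refine ⟨hrow, ?_⟩
  have hsum : ∀ d ≤ n, bumpedRow X U d + bumpedRow (insertRow X U) A d
      = bumpedRow X U' d + bumpedRow (insertRow X U') A' d := by
    intro d hd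
    have h1 := h.add_eq hU hA hU' hA' d hd
    have h2 := heq d hd
    simp only [bumpedRow]
    omega
  have hGE : ∀ d ≤ n, ∀ t, PairGE (bumpedRow X U) (bumpedRow (insertRow X U) A) 0 d t ↔
      PairGE (bumpedRow X U') (bumpedRow (insertRow X U') A') 0 d t := by
    intro d hd t
    rcases lt_or_ge d 2 with hd2 | hd2
    · have h1 := hb.zero
      have h2 := hb'.zero
      have h3 := hc.zero
      have h4 := hc'.zero
      have triv : ∀ V B : ℕ → ℤ, V 0 = 0 → B 0 = 0 → (PairGE V B 0 d t ↔ (d = 1 → t ≤ 0)) := by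
        intro V B hV hB
        constructor
        · rintro h rfl
          have := h 0 le_rfl one_pos
          simp only [zero_add] at this
          omega
        · intro h i _ hi
          obtain rfl : i = 0 := by omega
          obtain rfl : d = 1 := by omega
          have := h rfl
          simp only [zero_add]
          omega
      rw [triv _ _ h1 h3, triv _ _ h2 h4]
    · rw [← tripleGE_iff_pairGE hX hU hA hd2, ← tripleGE_iff_pairGE hX hU' hA' hd2,
        tripleGE_iff_fst hA, tripleGE_iff_fst hA']
      exact forall_congr' fun l => forall_congr' fun hl =>
        h.pairGE_iff hU hA hU' hA' (by omega) _
  -- Both bumped pairs have the same two-rowed tableau, hence the same passage times.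
  have hins : insertRow (bumpedRow X U) (bumpedRow (insertRow X U) A)
      = insertRow (bumpedRow X U') (bumpedRow (insertRow X U') A') := by
    refine (isRow_insertRow hb hc).ext (isRow_insertRow hb' hc') fun d hd => ?_
    rcases Nat.eq_zero_or_pos d with rfl | hd0
    · simp
    · have : ∀ t, insertRow (bumpedRow X U) (bumpedRow (insertRow X U) A) d ≤ t ↔
          insertRow (bumpedRow X U') (bumpedRow (insertRow X U') A') d ≤ t := by
        intro t
        rw [insertRow_le_iff hb hc hd0, insertRow_le_iff hb' hc' hd0, pairLE_iff_pairGE,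
          pairLE_iff_pairGE, hGE d hd]
        have h1 := hsum d hd
        have h2 := hsum 0 (Nat.zero_le n)
        rw [show ∀ a b c e : ℤ, a - b + (c - e) - t = (a + c) - (b + e) - t by intros; ring, h1, h2,
          show ∀ a b c e : ℤ, a - b + (c - e) - t = (a + c) - (b + e) - t by intros; ring]
      exact le_antisymm ((this _).2 le_rfl) ((this _).1 le_rfl)
  have hbump : bumpedRow (bumpedRow X U) (bumpedRow (insertRow X U) A)
      = bumpedRow (bumpedRow X U') (bumpedRow (insertRow X U') A') := by
    refine (isRow_bumpedRow hb hc).ext (isRow_bumpedRow hb' hc') fun d hd => ?_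
    have h1 := bumpedRow_add_insertRow (X := bumpedRow X U) (A := bumpedRow (insertRow X U) A) d
    have h2 := bumpedRow_add_insertRow (X := bumpedRow X U')
      (A := bumpedRow (insertRow X U') A') d
    have h3 := hsum d hd
    rw [hins] at h1
    omega
  have h1 := pairEquiv_bumpedRow_insertRow (n := n) (X := bumpedRow X U)
    (A := bumpedRow (insertRow X U) A)
  rw [hins, hbump] at h1
  exact h1.trans pairEquiv_bumpedRow_insertRow.symm

end Row

/-! ### The tableau of a list of rows, and its behaviour under rotation -/

/-- Successive insertion of a list of rows in the row `X`: the list of bumped rows and the final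
state of the row. -/
def insertRows : (ℕ → ℤ) → List (ℕ → ℤ) → List (ℕ → ℤ) × (ℕ → ℤ)
  | X, [] => ([], X)
  | X, A :: l =>
    (bumpedRow X A :: (insertRows (insertRow X A) l).1, (insertRows (insertRow X A) l).2)

/-- The rows bumped out of the first row of the tableau of a list of rows. -/
def bumpedRows (l : List (ℕ → ℤ)) : List (ℕ → ℤ) := (insertRows 0 l).1

/-- The `k`-th row, counted from `0`, of the tableau of a list of rows. -/
def tableauRow (l : List (ℕ → ℤ)) (k : ℕ) : ℕ → ℤ := (insertRows 0 (bumpedRows^[k] l)).2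

/-- The rows `m - 1, …, 0` of the tableau of `l`, the longest row last. -/
def tableauStack (l : List (ℕ → ℤ)) (m : ℕ) : List (ℕ → ℤ) :=
  (List.range m).reverse.map (tableauRow l)

/-- The equivalence of lists of rows generated by replacing two adjacent rows by an equivalent
pair. -/
inductive RowsEquiv (n : ℕ) : List (ℕ → ℤ) → List (ℕ → ℤ) → Prop
  | refl (l) : RowsEquiv n l l
  | trans {l₁ l₂ l₃} : RowsEquiv n l₁ l₂ → RowsEquiv n l₂ l₃ → RowsEquiv n l₁ l₃
  | cons {A l l'} : IsRow n A → RowsEquiv n l l' → RowsEquiv n (A :: l) (A :: l')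
  | pair {U A U' A'} (l) : IsRow n U → IsRow n A → IsRow n U' → IsRow n A' →
      PairEquiv n U A U' A' → RowsEquiv n (U :: A :: l) (U' :: A' :: l)

/-- Rotation by 180° of a row. -/
def rotateRow (n : ℕ) (R : ℕ → ℤ) (j : ℕ) : ℤ := R n - R (n - j)

/-- Rotation by 180° of a list of rows. -/
def rotateRows (n : ℕ) (l : List (ℕ → ℤ)) : List (ℕ → ℤ) := (l.map (rotateRow n)).reverse

section Rows

variable {n : ℕ} {l l' : List (ℕ → ℤ)} {X : ℕ → ℤ}

theorem isRow_insertRows (hX : IsRow n X) (hl : ∀ A ∈ l, IsRow n A) :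
    (∀ A ∈ (insertRows X l).1, IsRow n A) ∧ IsRow n (insertRows X l).2 := by
  induction l generalizing X with
  | nil => simpa [insertRows] using hX
  | cons A l ih =>
    rw [List.forall_mem_cons] at hl
    have h := ih (isRow_insertRow hX hl.1) hl.2
    simp only [insertRows, List.forall_mem_cons]
    exact ⟨⟨isRow_bumpedRow hX hl.1, h.1⟩, h.2⟩

theorem isRow_iterate_bumpedRows (hl : ∀ A ∈ l, IsRow n A) (k : ℕ) :
    ∀ A ∈ bumpedRows^[k] l, IsRow n A := by
  induction k with
  | zero => simpa using hl
  | succ k ih => rw [Function.iterate_succ_apply']; exact (isRow_insertRows isRow_zero ih).1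

theorem isRow_tableauRow (hl : ∀ A ∈ l, IsRow n A) (k : ℕ) : IsRow n (tableauRow l k) :=
  (isRow_insertRows isRow_zero (isRow_iterate_bumpedRows hl k)).2

theorem insertRows_append (X : ℕ → ℤ) (l l' : List (ℕ → ℤ)) :
    insertRows X (l ++ l') = ((insertRows X l).1 ++ (insertRows (insertRows X l).2 l').1,
      (insertRows (insertRows X l).2 l').2) := by
  induction l generalizing X with
  | nil => simp [insertRows]
  | cons A l ih => simp [insertRows, ih]

theorem insertRow_zero_right (hX : IsRow n X) : insertRow X 0 = X := by
  funext j
  induction j with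
  | zero => simp [hX.zero]
  | succ j ih => have := hX.mono j; rw [insertRow_succ, ih]; simp [this]

theorem insertRows_replicate_zero (hX : IsRow n X) (m : ℕ) :
    insertRows X (List.replicate m 0) = (List.replicate m 0, X) := by
  induction m with
  | zero => simp [insertRows]
  | succ m ih =>
    have : bumpedRow X 0 = 0 := by
      funext j
      simp [bumpedRow, insertRow_zero_right hX]
    simp [List.replicate_succ, insertRows, insertRow_zero_right hX, ih, this]

theorem tableauRow_append_replicate_zero (hl : ∀ A ∈ l, IsRow n A) (m k : ℕ) :
    tableauRow (l ++ List.replicate m 0) k = tableauRow l k := by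
  have h : bumpedRows^[k] (l ++ List.replicate m 0) = bumpedRows^[k] l ++ List.replicate m 0 := by
    induction k with
    | zero => rfl
    | succ k ih =>
      rw [Function.iterate_succ_apply', Function.iterate_succ_apply', ih, bumpedRows,
        insertRows_append, insertRows_replicate_zero
          (isRow_insertRows isRow_zero (isRow_iterate_bumpedRows hl k)).2, bumpedRows]
  rw [tableauRow, h, insertRows_append, insertRows_replicate_zero
    (isRow_insertRows isRow_zero (isRow_iterate_bumpedRows hl k)).2, tableauRow]

theorem RowsEquiv.insertRows (h : RowsEquiv n l l') (hX : IsRow n X) :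
    RowsEquiv n (insertRows X l).1 (insertRows X l').1 ∧
      (insertRows X l).2 = (insertRows X l').2 := by
  induction h generalizing X with
  | refl l => exact ⟨.refl _, rfl⟩
  | trans _ _ ih₁ ih₂ => exact ⟨(ih₁ hX).1.trans (ih₂ hX).1, (ih₁ hX).2.trans (ih₂ hX).2⟩
  | cons hA _ ih =>
    have h := ih (isRow_insertRow hX hA)
    simp only [_root_.insertRows]
    exact ⟨.cons (isRow_bumpedRow hX hA) h.1, h.2⟩
  | pair l hU hA hU' hA' h =>
    obtain ⟨h1, h2⟩ := h.insert hX hU hA hU' hA'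
    simp only [_root_.insertRows, h1, and_true]
    exact .pair _ (isRow_bumpedRow hX hU) (isRow_bumpedRow (isRow_insertRow hX hU) hA)
      (isRow_bumpedRow hX hU') (isRow_bumpedRow (isRow_insertRow hX hU') hA') h2

/-- Equivalent lists of rows have the same tableau. -/
theorem RowsEquiv.tableauRow_eq (h : RowsEquiv n l l') (k : ℕ) :
    tableauRow l k = tableauRow l' k := by
  have hk : RowsEquiv n (bumpedRows^[k] l) (bumpedRows^[k] l') := by
    induction k with
    | zero => exact h
    | succ k ih =>
      rw [Function.iterate_succ_apply', Function.iterate_succ_apply']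
      exact (ih.insertRows isRow_zero).1
  exact (hk.insertRows isRow_zero).2

theorem RowsEquiv.append_right (h : RowsEquiv n l l') (m : List (ℕ → ℤ)) :
    RowsEquiv n (l ++ m) (l' ++ m) := by
  induction h with
  | refl l => exact .refl _
  | trans _ _ ih₁ ih₂ => exact ih₁.trans ih₂
  | cons hA _ ih => exact .cons hA ih
  | pair l hU hA hU' hA' h => exact .pair _ hU hA hU' hA' h

/-- A row in front of a list can be moved to its end by row insertion. -/
theorem rowsEquiv_insertRows (hX : IsRow n X) (hl : ∀ A ∈ l, IsRow n A) :
    RowsEquiv n (X :: l) ((insertRows X l).1 ++ [(insertRows X l).2]) := by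
  induction l generalizing X with
  | nil => exact .refl _
  | cons A l ih =>
    rw [List.forall_mem_cons] at hl
    have h1 := isRow_insertRow hX hl.1
    have h2 := isRow_bumpedRow hX hl.1
    exact (RowsEquiv.pair l hX hl.1 h2 h1 pairEquiv_bumpedRow_insertRow).trans
      (.cons h2 (ih h1 hl.2))

/-- A list of rows is equivalent to its tableau. -/
theorem rowsEquiv_tableauStack (hl : ∀ A ∈ l, IsRow n A) (m : ℕ) :
    RowsEquiv n (List.replicate m 0 ++ l) (bumpedRows^[m] l ++ tableauStack l m) := by
  induction m with
  | zero => simpa [tableauStack] using RowsEquiv.refl l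
  | succ m ih =>
    have h1 := (rowsEquiv_insertRows isRow_zero (isRow_iterate_bumpedRows hl m)).append_right
      (tableauStack l m)
    have h2 := (RowsEquiv.cons isRow_zero ih).trans h1
    rw [Function.iterate_succ_apply', tableauStack, List.range_succ, List.reverse_append]
    rw [List.append_assoc] at h2
    exact h2

theorem isRow_rotateRow {R : ℕ → ℤ} (h : IsRow n R) : IsRow n (rotateRow n R) where
  zero := by simp [rotateRow]
  mono j := by
    have := h.monotone (show n - (j + 1) ≤ n - j by omega)
    simp only [rotateRow]
    omega
  const j hj := by simp only [rotateRow, show n - (j + 1) = n - j by omega]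

theorem pairLE_rotateRow {U A : ℕ → ℤ} {c d : ℕ} (hd : d ≤ n) (t : ℤ) :
    PairLE (rotateRow n A) (rotateRow n U) c d t ↔ PairLE U A (n - d) (n - c) t := by
  simp only [PairLE, rotateRow]
  constructor
  · intro h i hi hid
    have := h (n - (i + 1)) (by omega) (by omega)
    rw [show n - (n - (i + 1) + 1) = i by omega, show n - (n - (i + 1)) = i + 1 by omega] at this
    omega
  · intro h i hi hid
    have := h (n - (i + 1)) (by omega) (by omega)
    rw [show n - (i + 1) + 1 = n - i by omega] at this
    omega

theorem PairEquiv.rotate {U A U' A' : ℕ → ℤ} (h : PairEquiv n U A U' A') :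
    PairEquiv n (rotateRow n A) (rotateRow n U) (rotateRow n A') (rotateRow n U') := by
  intro c d t hcd hd
  rw [pairLE_rotateRow hd, pairLE_rotateRow hd]
  exact h _ _ t (by omega) (by omega)

theorem RowsEquiv.append_left {m : List (ℕ → ℤ)} (hm : ∀ A ∈ m, IsRow n A)
    (h : RowsEquiv n l l') : RowsEquiv n (m ++ l) (m ++ l') := by
  induction m with
  | nil => exact h
  | cons A m ih =>
    rw [List.forall_mem_cons] at hm
    exact .cons hm.1 (ih hm.2)

theorem isRow_rotateRows (hl : ∀ A ∈ l, IsRow n A) : ∀ A ∈ rotateRows n l, IsRow n A := by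
  intro A hA
  simp only [rotateRows, List.mem_reverse, List.mem_map] at hA
  obtain ⟨B, hB, rfl⟩ := hA
  exact isRow_rotateRow (hl B hB)

theorem rotateRows_append (l l' : List (ℕ → ℤ)) :
    rotateRows n (l ++ l') = rotateRows n l' ++ rotateRows n l := by
  simp [rotateRows]

theorem RowsEquiv.rotate (h : RowsEquiv n l l') (hl : ∀ A ∈ l, IsRow n A) :
    RowsEquiv n (rotateRows n l) (rotateRows n l') ∧ ∀ A ∈ l', IsRow n A := by
  induction h with
  | refl l => exact ⟨.refl _, hl⟩
  | trans _ _ ih₁ ih₂ =>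
    obtain ⟨h1, h1'⟩ := ih₁ hl
    obtain ⟨h2, h2'⟩ := ih₂ h1'
    exact ⟨h1.trans h2, h2'⟩
  | cons hA _ ih =>
    rw [List.forall_mem_cons] at hl
    obtain ⟨h1, h1'⟩ := ih hl.2
    rw [List.forall_mem_cons]
    refine ⟨?_, hA, h1'⟩
    simp only [rotateRows, List.map_cons, List.reverse_cons] at h1 ⊢
    exact h1.append_right _
  | pair l hU hA hU' hA' h =>
    simp only [List.forall_mem_cons] at hl ⊢
    refine ⟨?_, hU', hA', hl.2.2⟩
    simp only [rotateRows, List.map_cons, List.reverse_cons, List.append_assoc]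
    exact .append_left (isRow_rotateRows hl.2.2) (.pair [] (isRow_rotateRow hA)
      (isRow_rotateRow hU) (isRow_rotateRow hA') (isRow_rotateRow hU') h.rotate)

/-- The tableau of the rotated rows is a function of the tableau of the rows. -/
theorem tableauRow_rotateRows_congr (hl : ∀ A ∈ l, IsRow n A) (hl' : ∀ A ∈ l', IsRow n A) {m : ℕ}
    (h0 : bumpedRows^[m] l = bumpedRows^[m] l') (h : ∀ k < m, tableauRow l k = tableauRow l' k)
    (k : ℕ) : tableauRow (rotateRows n l) k = tableauRow (rotateRows n l') k := by
  have hs : tableauStack l m = tableauStack l' m := by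
    refine List.map_congr_left fun k hk => h k ?_
    simpa using hk
  have key : ∀ {l : List (ℕ → ℤ)}, (∀ A ∈ l, IsRow n A) → tableauRow (rotateRows n l) k =
      tableauRow (rotateRows n (bumpedRows^[m] l ++ tableauStack l m)) k := by
    intro l hl
    have hz : ∀ A ∈ List.replicate m (0 : ℕ → ℤ) ++ l, IsRow n A := by
      intro A hA
      rcases List.mem_append.1 hA with hA | hA
      · rw [List.eq_of_mem_replicate hA]; exact isRow_zero
      · exact hl A hA
    rw [← ((rowsEquiv_tableauStack hl m).rotate hz).1.tableauRow_eq, rotateRows_append]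
    have : rotateRows n (List.replicate m 0) = List.replicate m 0 := by
      have h0 : rotateRow n 0 = 0 := by funext j; simp [rotateRow]
      simp [rotateRows, h0]
    rw [this, tableauRow_append_replicate_zero (isRow_rotateRows hl)]
  rw [key hl, key hl', h0, hs]

end Rows

/-! ### Matrices symmetric about the anti-diagonal -/

/-- The partial sums of the `i`-th row of `e`. -/
def rowSum (e : ℕ → ℕ → ℤ) (i j : ℕ) : ℤ := ∑ b ∈ Finset.range j, e i b

/-- The first `n` rows of `e`. -/
def matrixRows (n : ℕ) (e : ℕ → ℕ → ℤ) : List (ℕ → ℤ) := (List.range' 0 n).map (rowSum e)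

/-- Rotation by 180° of an `n × n` matrix. -/
def rotateMatrix (n : ℕ) (e : ℕ → ℕ → ℤ) (i j : ℕ) : ℤ :=
  if i < n ∧ j < n then e (n - 1 - i) (n - 1 - j) else 0

section matrixRows

variable {n : ℕ} {e e' : ℕ → ℕ → ℤ}

theorem IsWeightMatrix.isRow_rowSum (he : IsWeightMatrix n e) (i : ℕ) : IsRow n (rowSum e i) where
  zero := by simp [rowSum]
  mono j := by
    have := he.nonneg i j
    rw [rowSum, rowSum, Finset.sum_range_succ]
    omega
  const j hj := by
    rw [rowSum, rowSum, Finset.sum_range_succ, he.zero i j (Or.inr hj), add_zero]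

theorem IsWeightMatrix.isRow_of_mem_matrixRows (he : IsWeightMatrix n e) :
    ∀ A ∈ matrixRows n e, IsRow n A := by
  intro A hA
  obtain ⟨i, -, rfl⟩ := List.mem_map.1 hA
  exact he.isRow_rowSum i

theorem insertRow_lpp (i : ℕ) : insertRow (lpp e i) (rowSum e i) = lpp e (i + 1) := by
  funext j
  induction j with
  | zero => simp
  | succ j ih =>
    rw [insertRow_succ, ih, lpp_succ, rowSum, rowSum, Finset.sum_range_succ]
    ring

theorem bumpedRow_lpp (i : ℕ) : bumpedRow (lpp e i) (rowSum e i) = rowSum (bumped e) i := by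
  funext j
  induction j with
  | zero => simp [bumpedRow, rowSum]
  | succ j ih =>
    have h1 : rowSum (bumped e) i (j + 1) = rowSum (bumped e) i j + bumped e i j := by
      rw [rowSum, Finset.sum_range_succ, rowSum]
    rw [h1, ← ih, bumpedRow_succ, bumpedRow, bumped, insertRow_lpp]
    ring

theorem insertRows_lpp (a m : ℕ) :
    insertRows (lpp e a) ((List.range' a m).map (rowSum e)) =
      ((List.range' a m).map (rowSum (bumped e)), lpp e (a + m)) := by
  induction m generalizing a with
  | zero => simp [insertRows]
  | succ m ih =>
    simp only [List.range'_succ, List.map_cons, insertRows, insertRow_lpp, bumpedRow_lpp, ih]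
    rw [show a + 1 + m = a + (m + 1) by ring]

theorem insertRows_matrixRows :
    insertRows 0 (matrixRows n e) = (matrixRows n (bumped e), lpp e n) := by
  have h := insertRows_lpp (e := e) 0 n
  have h0 : lpp e 0 = 0 := by funext j; simp
  rwa [h0, zero_add] at h

theorem iterate_bumpedRows_matrixRows (k : ℕ) :
    bumpedRows^[k] (matrixRows n e) = matrixRows n (bumped^[k] e) := by
  induction k with
  | zero => rfl
  | succ k ih =>
    rw [Function.iterate_succ_apply', ih, bumpedRows, insertRows_matrixRows,
      Function.iterate_succ_apply']

theorem tableauRow_matrixRows (k : ℕ) : tableauRow (matrixRows n e) k = part e k n := by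
  rw [tableauRow, iterate_bumpedRows_matrixRows, insertRows_matrixRows, part]

theorem IsWeightMatrix.rotateMatrix (he : IsWeightMatrix n e) :
    IsWeightMatrix n (rotateMatrix n e) where
  nonneg i j := by
    rw [_root_.rotateMatrix]
    split_ifs
    exacts [he.nonneg _ _, le_rfl]
  zero i j h := by rw [_root_.rotateMatrix, if_neg (by omega)]

theorem IsWeightMatrix.rotateRows_matrixRows (he : IsWeightMatrix n e) :
    rotateRows n (matrixRows n e) = matrixRows n (_root_.rotateMatrix n e) := by
  have hrow : ∀ i < n, rotateRow n (rowSum e i) = rowSum (_root_.rotateMatrix n e) (n - 1 - i) := by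
    intro i hi
    refine (isRow_rotateRow (he.isRow_rowSum i)).ext (he.rotateMatrix.isRow_rowSum _) fun j hj => ?_
    induction j with
    | zero => simp [rotateRow, rowSum]
    | succ j ih =>
      have h1 := ih (by omega)
      have h2 : rowSum e i (n - j) = rowSum e i (n - (j + 1)) + e i (n - (j + 1)) := by
        rw [show n - j = n - (j + 1) + 1 by omega, rowSum, Finset.sum_range_succ, rowSum]
      have h3 : rowSum (_root_.rotateMatrix n e) (n - 1 - i) (j + 1) =
          rowSum (_root_.rotateMatrix n e) (n - 1 - i) j + e i (n - (j + 1)) := by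
        rw [rowSum, Finset.sum_range_succ, rowSum, _root_.rotateMatrix, if_pos (by omega)]
        congr 2 <;> omega
      rw [h3, ← h1, rotateRow, rotateRow, h2]
      ring
  refine List.ext_getElem (by simp [rotateRows, matrixRows]) fun i h1 h2 => ?_
  have hi : i < n := by simpa [matrixRows] using h2
  simp only [rotateRows, matrixRows, List.getElem_reverse, List.getElem_map, List.getElem_range',
    List.length_map, List.length_range']
  rw [hrow _ (by omega)]
  congr 1
  omega

/-- The partitions along the edge `i = n` of the growth diagram of the rotated matrix are determined
by those of the matrix itself. -/
theorem part_rotateMatrix_congr (he : IsWeightMatrix n e) (he' : IsWeightMatrix n e')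
    (h : ∀ k < n, part e k n = part e' k n) (k : ℕ) :
    part (rotateMatrix n e) k n = part (rotateMatrix n e') k n := by
  rw [← tableauRow_matrixRows, ← tableauRow_matrixRows, ← he.rotateRows_matrixRows,
    ← he'.rotateRows_matrixRows]
  refine tableauRow_rotateRows_congr he.isRow_of_mem_matrixRows he'.isRow_of_mem_matrixRows
    (m := n) ?_ (fun k hk => ?_) k
  · rw [iterate_bumpedRows_matrixRows, iterate_bumpedRows_matrixRows]
    refine List.map_congr_left fun i hi => ?_
    have hi : i < n := by simpa using hi
    funext j
    simp only [rowSum, iterate_bumped_eq_zero he.nonneg n i _ (Or.inl hi),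
      iterate_bumped_eq_zero he'.nonneg n i _ (Or.inl hi)]
  · rw [tableauRow_matrixRows, tableauRow_matrixRows, h k hk]

/-- The partitions along the edge `i = n` do not change beyond column `n`. -/
theorem IsWeightMatrix.part_ext (he : IsWeightMatrix n e) (he' : IsWeightMatrix n e') {k : ℕ}
    (h : ∀ j ≤ n, part e k n j = part e' k n j) : part e k n = part e' k n := by
  rw [← tableauRow_matrixRows, ← tableauRow_matrixRows] at h ⊢
  exact (isRow_tableauRow he.isRow_of_mem_matrixRows k).ext
    (isRow_tableauRow he'.isRow_of_mem_matrixRows k) h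

end matrixRows

/-- Symmetry of an `n × n` matrix about its anti-diagonal. -/
def IsAntiSymmetric (n : ℕ) (e : ℕ → ℕ → ℤ) : Prop :=
  ∀ i < n, ∀ j < n, e i j = e (n - 1 - j) (n - 1 - i)

section antisymmetric

variable {n : ℕ} {e e' : ℕ → ℕ → ℤ}

theorem IsAntiSymmetric.rotateMatrix_eq (h : IsAntiSymmetric n e) (he : IsWeightMatrix n e) :
    rotateMatrix n e = fun i j => e j i := by
  funext i j
  rw [rotateMatrix]
  split_ifs with hij
  · exact (h j hij.2 i hij.1).symm
  · exact (he.zero _ _ (by omega)).symm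

/-- A matrix symmetric about the anti-diagonal is determined by one of its two tableaux, because
rotation by 180° then amounts to transposition, which exchanges the tableaux. -/
theorem IsAntiSymmetric.eq_of_part_eq (h : IsAntiSymmetric n e) (he : IsWeightMatrix n e)
    (h' : IsAntiSymmetric n e') (he' : IsWeightMatrix n e')
    (hp : ∀ k < n, ∀ j ≤ n, part e k n j = part e' k n j) : e = e' := by
  have hp' : ∀ k < n, part e k n = part e' k n := fun k hk => he.part_ext he' (hp k hk)
  have hq := part_rotateMatrix_congr he he' hp'
  rw [h.rotateMatrix_eq he, h'.rotateMatrix_eq he'] at hq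
  have hq' : ∀ k j, part e k j n = part e' k j n := fun k j => by
    rw [← part_transpose, ← part_transpose (e := e'), hq]
  refine toPlanePartition_injOn he he' ?_
  funext i j
  by_cases hij : n ≤ i ∨ n ≤ j
  · rw [(isPlanePartition_toPlanePartition he).zero _ _ hij,
      (isPlanePartition_toPlanePartition he').zero _ _ hij]
  · rw [toPlanePartition, toPlanePartition]
    rcases le_total i j with hle | hle
    · rw [Nat.sub_eq_zero_of_le hle, Nat.sub_zero, hp' _ (by omega)]
    · rw [Nat.sub_eq_zero_of_le hle, Nat.sub_zero, hq']

end antisymmetric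

section finite

/-- There are finitely many bounded non-negative matrices. -/
theorem finite_setOf_bounded (n : ℕ) (c : ℤ) : {f : ℕ → ℕ → ℤ |
    (∀ i j, 0 ≤ f i j) ∧ (∀ i j, n ≤ i ∨ n ≤ j → f i j = 0) ∧ ∀ i j, f i j ≤ c}.Finite := by
  refine Set.Finite.of_injOn (f := fun f (p : Fin n × Fin n) => f p.1 p.2)
    (t := Set.Icc 0 (fun _ => c)) ?_ ?_ (Set.finite_Icc _ _)
  · rintro f ⟨h0, -, hc⟩
    exact ⟨fun p => h0 _ _, fun p => hc _ _⟩
  · rintro f ⟨-, hf, -⟩ g ⟨-, hg, -⟩ h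
    funext i j
    by_cases hij : n ≤ i ∨ n ≤ j
    · rw [hf i j hij, hg i j hij]
    · push Not at hij
      exact congrFun h (⟨i, hij.1⟩, ⟨j, hij.2⟩)

variable {n : ℕ} {e ρ : ℕ → ℕ → ℤ}

theorem IsWeightMatrix.total_nonneg (he : IsWeightMatrix n e) : 0 ≤ total n e :=
  Finset.sum_nonneg fun _ _ => Finset.sum_nonneg fun _ _ => he.nonneg _ _

theorem IsWeightMatrix.le_total (he : IsWeightMatrix n e) (i j : ℕ) : e i j ≤ total n e := by
  by_cases hij : n ≤ i ∨ n ≤ j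
  · rw [he.zero i j hij]; exact he.total_nonneg
  · push Not at hij
    exact (Finset.single_le_sum (f := fun j => e i j) (fun _ _ => he.nonneg _ _)
      (Finset.mem_range.2 hij.2)).trans
      (Finset.single_le_sum (f := fun i => ∑ j ∈ Finset.range n, e i j)
        (fun _ _ => Finset.sum_nonneg fun _ _ => he.nonneg _ _) (Finset.mem_range.2 hij.1))

theorem IsPlanePartition.le_corner (h : IsPlanePartition n ρ) (i j : ℕ) : ρ i j ≤ ρ 0 0 := by
  have h1 : ∀ i, ρ i j ≤ ρ 0 j := by
    intro i
    induction i with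
    | zero => exact le_rfl
    | succ i ih => exact (h.anti_left i j).trans ih
  have h2 : ∀ j, ρ 0 j ≤ ρ 0 0 := by
    intro j
    induction j with
    | zero => exact le_rfl
    | succ j ih => exact (h.anti_right 0 j).trans ih
  exact (h1 i).trans (h2 j)

end finite

section antisymmetric

variable {n : ℕ} {e e' ρ : ℕ → ℕ → ℤ}

/-- The plane partition symmetric about its main diagonal which is obtained by gluing the first
tableau of `e` to itself. -/
def doubledTableau (n : ℕ) (e : ℕ → ℕ → ℤ) (i j : ℕ) : ℤ :=
  toPlanePartition n e (min i j) (max i j)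

/-- Reflection of an `n × n` matrix in a horizontal line. -/
def flipRows (n : ℕ) (e : ℕ → ℕ → ℤ) (i j : ℕ) : ℤ :=
  if i < n ∧ j < n then e (n - 1 - i) j else 0

theorem IsPlanePartition.symmetrize (h : IsPlanePartition n ρ) :
    IsPlanePartition n fun i j => ρ (min i j) (max i j) where
  nonneg i j := h.nonneg _ _
  zero i j hij := h.zero _ _ (by omega)
  anti_left i j := by
    rcases le_or_gt j i with hij | hij
    · rw [min_eq_right (by omega), max_eq_left (by omega), min_eq_right hij, max_eq_left hij]
      exact h.anti_right j i
    · rw [min_eq_left (by omega), max_eq_right (by omega), min_eq_left hij.le, max_eq_right hij.le]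
      exact h.anti_left i j
  anti_right i j := by
    rcases le_or_gt i j with hij | hij
    · rw [min_eq_left (by omega), max_eq_right (by omega), min_eq_left hij, max_eq_right hij]
      exact h.anti_right i j
    · rw [min_eq_right (by omega), max_eq_left (by omega), min_eq_right hij.le, max_eq_left hij.le]
      exact h.anti_left j i

theorem IsAntiSymmetric.eq_of_doubledTableau_eq (h : IsAntiSymmetric n e)
    (he : IsWeightMatrix n e) (h' : IsAntiSymmetric n e') (he' : IsWeightMatrix n e')
    (heq : doubledTableau n e = doubledTableau n e') : e = e' := by
  refine h.eq_of_part_eq he h' he' fun k _ j hj => ?_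
  have := congrFun (congrFun heq k) (k + (n - j))
  simp only [doubledTableau, toPlanePartition, min_eq_left (Nat.le_add_right k (n - j)),
    max_eq_right (Nat.le_add_right k (n - j))] at this
  rwa [show k - (k + (n - j)) = 0 by omega, show n - (k + (n - j) - k) = j by omega,
    Nat.sub_zero] at this

theorem IsWeightMatrix.flipRows (he : IsWeightMatrix n e) : IsWeightMatrix n (flipRows n e) where
  nonneg i j := by
    rw [_root_.flipRows]
    split_ifs
    exacts [he.nonneg _ _, le_rfl]
  zero i j h := by rw [_root_.flipRows, if_neg (by omega)]

theorem total_flipRows : total n (flipRows n e) = total n e := by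
  rw [total, total, ← Finset.sum_range_reflect]
  refine Finset.sum_congr rfl fun i hi => Finset.sum_congr rfl fun j hj => ?_
  rw [Finset.mem_range] at hi hj
  rw [flipRows, if_pos (by omega)]
  congr 1
  omega

theorem flipRows_injOn : Set.InjOn (flipRows n) {e | IsWeightMatrix n e} := by
  intro e he e' he' h
  funext i j
  by_cases hij : n ≤ i ∨ n ≤ j
  · rw [he.zero i j hij, he'.zero i j hij]
  · have := congrFun (congrFun h (n - 1 - i)) j
    rw [flipRows, flipRows, if_pos (by omega), if_pos (by omega),
      show n - 1 - (n - 1 - i) = i by omega] at this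
    exact this

/-- Matrices symmetric about the anti-diagonal correspond to symmetric plane partitions. The map is
injective, and it is onto because, for a fixed total, reflecting the rows turns the matrices
symmetric about the anti-diagonal into the symmetric ones, which are as numerous as the symmetric
plane partitions. -/
theorem bijOn_doubledTableau (n : ℕ) : Set.BijOn (doubledTableau n)
    {e | IsWeightMatrix n e ∧ IsAntiSymmetric n e}
    {ρ | IsPlanePartition n ρ ∧ (True → ∀ i j, ρ i j = ρ j i)} := by
  have hmaps : ∀ e, IsWeightMatrix n e → IsPlanePartition n (doubledTableau n e) ∧
      (True → ∀ i j, doubledTableau n e i j = doubledTableau n e j i) := fun e he =>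
    ⟨(isPlanePartition_toPlanePartition he).symmetrize, fun _ i j => by
      rw [doubledTableau, min_comm, max_comm, doubledTableau]⟩
  have htr : ∀ e, IsWeightMatrix n e →
      ∑ i ∈ Finset.range n, doubledTableau n e i i = total n e := fun e he => by
    rw [← sum_toPlanePartition_diag he.nonneg]
    simp [doubledTableau]
  have hinj : Set.InjOn (doubledTableau n) {e | IsWeightMatrix n e ∧ IsAntiSymmetric n e} :=
    fun e he e' he' h => he.2.eq_of_doubledTableau_eq he.1 he'.2 he'.1 h
  refine ⟨fun e he => hmaps e he.1, hinj, fun ρ hρ => ?_⟩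
  set s := ∑ i ∈ Finset.range n, ρ i i with hs
  have hfin : ∀ Q : (ℕ → ℕ → ℤ) → Prop,
      {e | (IsWeightMatrix n e ∧ Q e) ∧ total n e = s}.Finite := fun Q => by
    refine (finite_setOf_bounded n s).subset ?_
    rintro e ⟨⟨he, -⟩, ht⟩
    exact ⟨he.nonneg, he.zero, fun i j => ht ▸ he.le_total i j⟩
  set A := {e | (IsWeightMatrix n e ∧ IsAntiSymmetric n e) ∧ total n e = s}
  set S := {e | (IsWeightMatrix n e ∧ (True → ∀ i j, e i j = e j i)) ∧ total n e = s}
  set B := {ρ | (IsPlanePartition n ρ ∧ (True → ∀ i j, ρ i j = ρ j i)) ∧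
    ∑ i ∈ Finset.range n, ρ i i = s}
  have hSB : toPlanePartition n '' S = B := by
    have hb := bijOn_toPlanePartition n True
    ext σ
    constructor
    · rintro ⟨e, he, rfl⟩
      exact ⟨hb.mapsTo he.1, (sum_toPlanePartition_diag he.1.1.nonneg).trans he.2⟩
    · rintro ⟨hσ, hσs⟩
      obtain ⟨e, he, rfl⟩ := hb.surjOn hσ
      exact ⟨e, ⟨he, (sum_toPlanePartition_diag he.1.nonneg).symm.trans hσs⟩, rfl⟩
  have hcard1 : B.ncard = S.ncard := by
    rw [← hSB]
    exact (toPlanePartition_injOn.mono fun e he => he.1.1).ncard_image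
  have hcard2 : S.ncard ≤ A.ncard := by
    refine Set.ncard_le_ncard_of_injOn (flipRows n) ?_ (flipRows_injOn.mono fun e he => he.1.1)
      (hfin _)
    rintro e ⟨⟨he, hsym⟩, ht⟩
    refine ⟨⟨he.flipRows, fun i hi j hj => ?_⟩, total_flipRows.trans ht⟩
    rw [flipRows, flipRows, if_pos (by omega), if_pos (by omega), hsym trivial]
    congr 1
    omega
  have hAB : doubledTableau n '' A = B := by
    refine Set.eq_of_subset_of_ncard_le ?_ ?_ (hSB ▸ (hfin _).image _)
    · rintro _ ⟨e, he, rfl⟩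
      exact ⟨hmaps e he.1.1, (htr e he.1.1).trans he.2⟩
    · rw [(hinj.mono fun e he => he.1).ncard_image, hcard1]
      exact hcard2
  obtain ⟨e, he, rfl⟩ : ρ ∈ doubledTableau n '' A := hAB ▸ ⟨hρ, rfl⟩
  exact ⟨e, he.1, rfl⟩

end antisymmetric

/-! ### Log-concavity of the weighted count of plane partitions -/

/-- The `n × n` plane partitions, symmetric ones only if `symm` holds, with corner entry `k`. -/
def planePartitions (n : ℕ) (symm : Prop) (k : ℤ) : Set (ℕ → ℕ → ℤ) :=
  {ρ | (IsPlanePartition n ρ ∧ (symm → ∀ i j, ρ i j = ρ j i)) ∧ ρ 0 0 = k}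

/-- The sum of the diagonal entries of an `n × n` plane partition. -/
def diagonalSum (n : ℕ) (ρ : ℕ → ℕ → ℤ) : ℤ := ∑ i ∈ Finset.range n, ρ i i

theorem finite_planePartitions (n : ℕ) (symm : Prop) (k : ℤ) :
    (planePartitions n symm k).Finite := by
  refine (finite_setOf_bounded n k).subset ?_
  rintro ρ ⟨⟨h, -⟩, hk⟩
  exact ⟨h.nonneg, h.zero, fun i j => hk ▸ h.le_corner i j⟩

/-- The plane partitions with corner `k`, counted with weight `z ^ diagonalSum`. -/
noncomputable def traceCount (n : ℕ) (symm : Prop) (z : ℝ) (k : ℤ) : ℝ :=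
  ∑ᶠ ρ ∈ planePartitions n symm k, z ^ (diagonalSum n ρ).toNat

/-- The indicator function of the `n × n` square. -/
def squareIndicator (n i j : ℕ) : ℤ := if i < n ∧ j < n then 1 else 0

section LogConcave

variable {n : ℕ} {symm : Prop} {z : ℝ}

theorem traceCount_eq_sum (k : ℤ) : traceCount n symm z k =
    ∑ ρ ∈ (finite_planePartitions n symm k).toFinset, z ^ (diagonalSum n ρ).toNat :=
  finsum_mem_eq_finite_toFinset_sum _ _

theorem IsPlanePartition.trace_nonneg {ρ : ℕ → ℕ → ℤ} (h : IsPlanePartition n ρ) :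
    0 ≤ diagonalSum n ρ := Finset.sum_nonneg fun _ _ => h.nonneg _ _

theorem squareIndicator_anti (i j : ℕ) : squareIndicator n (i + 1) j ≤ squareIndicator n i j ∧
    squareIndicator n i (j + 1) ≤ squareIndicator n i j := by
  simp only [squareIndicator]
  constructor <;> split_ifs <;> omega

theorem squareIndicator_symm (i j : ℕ) : squareIndicator n i j = squareIndicator n j i := by
  simp only [squareIndicator, and_comm]

/-- Plane partitions are closed under the two operations which move the corner values `k - 1`
and `k + 1` both to `k`. -/
theorem IsPlanePartition.shift_inf_sup {π σ : ℕ → ℕ → ℤ} (hπ : IsPlanePartition n π)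
    (hσ : IsPlanePartition n σ) :
    IsPlanePartition n ((π + squareIndicator n) ⊓ σ) ∧
      IsPlanePartition n ((π + squareIndicator n) ⊔ σ - squareIndicator n) := by
  have hs : ∀ i j, squareIndicator n i j = 1 ∨ (n ≤ i ∨ n ≤ j) ∧ squareIndicator n i j = 0 := by
    intro i j
    simp only [squareIndicator]
    split_ifs <;> omega
  refine ⟨⟨fun i j => ?_, fun i j hij => ?_, fun i j => ?_, fun i j => ?_⟩,
    ⟨fun i j => ?_, fun i j hij => ?_, fun i j => ?_, fun i j => ?_⟩⟩ <;>
    simp only [Pi.inf_apply, Pi.sup_apply, Pi.add_apply, Pi.sub_apply]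
  · have h1 := hπ.nonneg i j
    have h2 := hσ.nonneg i j
    rcases hs i j with h | ⟨-, h⟩ <;> omega
  · rw [hπ.zero i j hij, hσ.zero i j hij, squareIndicator, if_neg (by omega)]
    simp
  · have h1 := hπ.anti_left i j
    have h2 := hσ.anti_left i j
    have h3 := (squareIndicator_anti (n := n) i j).1
    omega
  · have h1 := hπ.anti_right i j
    have h2 := hσ.anti_right i j
    have h3 := (squareIndicator_anti (n := n) i j).2
    omega
  · have h1 := hπ.nonneg i j
    omega
  · rw [hπ.zero i j hij, hσ.zero i j hij, squareIndicator, if_neg (by omega)]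
    simp
  · have h1 := hπ.anti_left i j
    have h2 := hσ.anti_left i j
    have h3 := hπ.nonneg i j
    rcases hs (i + 1) j with h | ⟨h, h'⟩
    · have := (squareIndicator_anti (n := n) i j).1
      rcases hs i j with h' | ⟨-, h'⟩ <;> omega
    · rw [hπ.zero _ _ h, hσ.zero _ _ h, h']
      simp only [add_zero, max_self, sub_zero]
      omega
  · have h1 := hπ.anti_right i j
    have h2 := hσ.anti_right i j
    have h3 := hπ.nonneg i j
    rcases hs i (j + 1) with h | ⟨h, h'⟩
    · have := (squareIndicator_anti (n := n) i j).2
      rcases hs i j with h' | ⟨-, h'⟩ <;> omega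
    · rw [hπ.zero _ _ h, hσ.zero _ _ h, h']
      simp only [add_zero, max_self, sub_zero]
      omega

theorem traceCount_mul_le (hn : 1 ≤ n) (hz : 0 ≤ z) (k : ℤ) :
    traceCount n symm z (k - 1) * traceCount n symm z (k + 1) ≤ traceCount n symm z k ^ 2 := by
  classical
  set s := squareIndicator n with hs
  have hs0 : s 0 0 = 1 := by rw [hs, squareIndicator, if_pos (by omega)]
  let R : Set (ℕ → ℕ → ℤ) := {ρ | IsPlanePartition n ρ ∧ (symm → ∀ i j, ρ i j = ρ j i)}
  let g : (ℕ → ℕ → ℤ) → ℝ := fun ρ => if ρ ∈ R then z ^ (diagonalSum n ρ).toNat else 0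
  let S : ℤ → Finset (ℕ → ℕ → ℤ) := fun k => (finite_planePartitions n symm k).toFinset
  have hS : ∀ k ρ, ρ ∈ S k ↔ ρ ∈ R ∧ ρ 0 0 = k := fun k ρ => Set.Finite.mem_toFinset _
  have hg : ∀ ρ, 0 ≤ g ρ := fun ρ => by simp only [g]; split_ifs <;> positivity
  have ha : ∀ k, traceCount n symm z k = ∑ ρ ∈ S k, g ρ := fun k => by
    rw [traceCount_eq_sum]
    refine Finset.sum_congr rfl fun ρ hρ => ?_
    simp only [g]
    rw [if_pos ((hS k ρ).1 hρ).1]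
  have hR : ∀ π ∈ R, ∀ σ ∈ R, (π + s) ⊓ σ ∈ R ∧ (π + s) ⊔ σ - s ∈ R := by
    intro π hπ σ hσ
    have h := hπ.1.shift_inf_sup hσ.1
    refine ⟨⟨h.1, fun hsym i j => ?_⟩, ⟨h.2, fun hsym i j => ?_⟩⟩ <;>
      simp only [Pi.inf_apply, Pi.sup_apply, Pi.add_apply, Pi.sub_apply, hπ.2 hsym i j,
        hσ.2 hsym i j, hs, squareIndicator_symm i j]
  have hfour := four_functions_theorem (fun a => g (a - s)) g g (fun a => g (a - s))
    (fun _ => hg _) hg hg (fun _ => hg _) (fun a b => ?_) ((S (k - 1)).image (· + s)) (S (k + 1))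
  · rw [ha, ha, ha, sq]
    have h1 : ∑ a ∈ (S (k - 1)).image (· + s), g (a - s) = ∑ ρ ∈ S (k - 1), g ρ := by
      rw [Finset.sum_image fun a _ b _ h => add_right_cancel h]
      simp
    rw [h1] at hfour
    refine hfour.trans (mul_le_mul ?_ ?_ (Finset.sum_nonneg fun _ _ => hg _)
      (Finset.sum_nonneg fun _ _ => hg _))
    · refine Finset.sum_le_sum_of_subset_of_nonneg (fun ρ hρ => ?_) fun _ _ _ => hg _
      obtain ⟨a, ha, σ, hσ, rfl⟩ := Finset.mem_infs.1 hρ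
      obtain ⟨π, hπ, rfl⟩ := Finset.mem_image.1 ha
      rw [hS] at hπ hσ ⊢
      refine ⟨(hR π hπ.1 σ hσ.1).1, ?_⟩
      simp only [Pi.inf_apply, Pi.add_apply, hπ.2, hσ.2, hs0]
      omega
    · rw [← Finset.sum_image (g := fun a => a - s) (f := g) fun a _ b _ h => sub_left_injective h]
      refine Finset.sum_le_sum_of_subset_of_nonneg (fun ρ hρ => ?_) fun _ _ _ => hg _
      obtain ⟨b, hb, rfl⟩ := Finset.mem_image.1 hρ
      obtain ⟨a, ha, σ, hσ, rfl⟩ := Finset.mem_sups.1 hb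
      obtain ⟨π, hπ, rfl⟩ := Finset.mem_image.1 ha
      rw [hS] at hπ hσ ⊢
      refine ⟨(hR π hπ.1 σ hσ.1).2, ?_⟩
      simp only [Pi.sup_apply, Pi.add_apply, Pi.sub_apply, hπ.2, hσ.2, hs0]
      omega
  · by_cases hab : a - s ∈ R ∧ b ∈ R
    · obtain ⟨hA, hB⟩ := hab
      have h := hR _ hA _ hB
      rw [sub_add_cancel] at h
      simp only [g]
      rw [if_pos hA, if_pos hB, if_pos h.1, if_pos h.2, ← pow_add, ← pow_add]
      have htr : diagonalSum n (a - s) + diagonalSum n b = diagonalSum n (a ⊓ b) + diagonalSum n (a ⊔ b - s) := by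
        simp only [diagonalSum, ← Finset.sum_add_distrib]
        refine Finset.sum_congr rfl fun i _ => ?_
        simp only [Pi.inf_apply, Pi.sup_apply, Pi.sub_apply]
        omega
      have h1 := hA.1.trace_nonneg
      have h2 := hB.1.trace_nonneg
      have h3 := h.1.1.trace_nonneg
      have h4 := h.2.1.trace_nonneg
      rw [show (diagonalSum n (a - s)).toNat + (diagonalSum n b).toNat
        = (diagonalSum n (a ⊓ b)).toNat + (diagonalSum n (a ⊔ b - s)).toNat by omega]
    · have h0 : g (a - s) * g b = 0 := by
        rcases not_and_or.1 hab with h | h <;> simp only [g, if_neg h, zero_mul, mul_zero]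
      rw [h0]
      exact mul_nonneg (hg _) (hg _)

theorem isLogConcaveSeq_traceCount (hn : 1 ≤ n) (symm : Prop) (hz : 0 ≤ z) :
    IsLogConcaveSeq (traceCount n symm z) := by
  refine ⟨fun k => ?_, traceCount_mul_le hn hz, fun i j k hij hjk hi hk => ?_⟩
  · rw [traceCount_eq_sum]
    exact Finset.sum_nonneg fun _ _ => by positivity
  · rw [traceCount_eq_sum] at hi hk
    obtain ⟨π, hπ, -⟩ := Finset.exists_ne_zero_of_sum_ne_zero hi
    obtain ⟨σ, hσ, hσz⟩ := Finset.exists_ne_zero_of_sum_ne_zero hk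
    rw [Set.Finite.mem_toFinset] at hπ hσ
    have hi0 : 0 ≤ i := hπ.2 ▸ hπ.1.1.nonneg 0 0
    have hz0 : 0 < z := by
      refine hz.lt_of_ne' fun h0 => hσz ?_
      have h1 : σ 0 0 ≤ diagonalSum n σ := Finset.single_le_sum (f := fun i => σ i i)
        (fun _ _ => hσ.1.1.nonneg _ _) (Finset.mem_range.2 hn)
      have h2 := hσ.2
      rw [h0, zero_pow (by omega)]
    rw [traceCount_eq_sum]
    refine (Finset.sum_pos (fun _ _ => by positivity)
      ⟨fun a b => if a = 0 ∧ b = 0 then j else 0, ?_⟩).ne'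
    rw [Set.Finite.mem_toFinset]
    refine ⟨⟨⟨fun a b => ?_, fun a b hab => ?_, fun a b => ?_, fun a b => ?_⟩, fun _ a b => ?_⟩,
      by simp⟩
    · split_ifs <;> omega
    · rw [if_neg (by omega)]
    · rw [if_neg (by omega)]; split_ifs <;> omega
    · rw [if_neg (by omega)]; split_ifs <;> omega
    · simp only [and_comm]

theorem IsLogConcaveSeq.const_mul {a : ℤ → ℝ} (h : IsLogConcaveSeq a) {c : ℝ} (hc : 0 ≤ c) :
    IsLogConcaveSeq fun k => c * a k := by
  refine ⟨fun k => mul_nonneg hc (h.1 k), fun k => ?_, fun i j k hij hjk hi hk => ?_⟩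
  · have := mul_le_mul_of_nonneg_left (h.2.1 k) (mul_nonneg hc hc)
    calc c * a (k - 1) * (c * a (k + 1)) = c * c * (a (k - 1) * a (k + 1)) := by ring
      _ ≤ c * c * a k ^ 2 := this
      _ = (c * a k) ^ 2 := by ring
  · rw [mul_ne_zero_iff] at hi hk ⊢
    exact ⟨hi.1, h.2.2 i j k hij hjk hi.2 hk.2⟩

end LogConcave

/-! ### Passage times as maxima over lattice paths -/

theorem IsUpRightPath.concat {a b c : ℕ × ℕ} {γ : List (ℕ × ℕ)} (h : IsUpRightPath a b γ)
    (hc : c = (b.1 + 1, b.2) ∨ c = (b.1, b.2 + 1)) : IsUpRightPath a c (γ ++ [c]) := by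
  obtain ⟨h1, h2, h3⟩ := h
  refine ⟨by rw [List.head?_append, h1]; rfl, by simp, ?_⟩
  rw [List.isChain_append]
  refine ⟨h3, by simp, fun x hx y hy => ?_⟩
  rw [h2] at hx
  simp only [Option.mem_def, Option.some.injEq, List.head?_cons] at hx hy
  subst hx hy
  exact hc

theorem IsUpRightPath.eq_concat {a c : ℕ × ℕ} {γ : List (ℕ × ℕ)} (h : IsUpRightPath a c γ) :
    γ = [c] ∧ a = c ∨ ∃ γ' b, γ = γ' ++ [c] ∧ IsUpRightPath a b γ' ∧
      (c = (b.1 + 1, b.2) ∨ c = (b.1, b.2 + 1)) := by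
  obtain ⟨h1, h2, h3⟩ := h
  rcases List.eq_nil_or_concat' γ with rfl | ⟨γ', d, rfl⟩
  · simp at h1
  · simp only [List.getLast?_append, List.getLast?_singleton, Option.some_or,
      Option.some.injEq] at h2
    subst h2
    rw [List.isChain_append] at h3
    rcases hγ : γ'.getLast? with _ | b
    · rw [List.getLast?_eq_none_iff] at hγ
      subst hγ
      left
      simpa using h1.symm
    · right
      refine ⟨γ', b, rfl, ⟨?_, hγ, h3.1⟩, h3.2.2 b hγ _ (by simp)⟩
      cases γ' with
      | nil => simp at hγ
      | cons x l => simpa using h1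

theorem passageTime_eq_lpp (ζ : ℕ × ℕ → ℕ) (i j : ℕ) :
    (passageTime ζ (1, 1) (i + 1, j + 1) : ℤ) =
      lpp (fun i j => (ζ (i + 1, j + 1) : ℤ)) (i + 1) (j + 1) := by
  set e : ℕ → ℕ → ℤ := fun i j => (ζ (i + 1, j + 1) : ℤ) with he
  have hpos : ∀ {b γ}, IsUpRightPath (1, 1) b γ → 1 ≤ b.1 ∧ 1 ≤ b.2 := by
    intro b γ h
    have hb : b ∈ γ := List.mem_of_getLast? h.2.1
    exact (Finset.mem_Icc.1 ((IsUpRightPath.subset_and_nodup γ h).1 b hb)).1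
  have hone : IsUpRightPath (1, 1) (1, 1) [(1, 1)] := by simp [IsUpRightPath]
  suffices key : ∀ d i j, i + j = d →
      (∀ γ, IsUpRightPath (1, 1) (i + 1, j + 1) γ →
        ((γ.map ζ).sum : ℤ) ≤ lpp e (i + 1) (j + 1)) ∧
      ∃ γ, IsUpRightPath (1, 1) (i + 1, j + 1) γ ∧
        ((γ.map ζ).sum : ℤ) = lpp e (i + 1) (j + 1) by
    obtain ⟨hle, γ, hγ, hγs⟩ := key _ i j rfl
    obtain ⟨⟨γ', hγ', hs⟩, hub⟩ := isGreatest_passageTime ζ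
      (a := (1, 1)) (b := (i + 1, j + 1)) (Prod.mk_le_mk.2 ⟨by omega, by omega⟩)
    refine le_antisymm (hs ▸ hle γ' hγ') ?_
    rw [← hγs]
    exact_mod_cast hub ⟨γ, hγ, rfl⟩
  intro d
  induction d with
  | zero =>
    intro i j hij
    obtain ⟨rfl, rfl⟩ : i = 0 ∧ j = 0 := by omega
    refine ⟨fun γ hγ => ?_, _, hone, by simp [lpp, he]⟩
    rcases hγ.eq_concat with ⟨rfl, -⟩ | ⟨γ', b, -, hb, hc⟩
    · simp [lpp, he]
    · have := hpos hb
      rcases hc with hc | hc <;> simp only [Prod.mk.injEq] at hc <;> omega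
  | succ d ih =>
    intro i j hij
    have hs : ∀ γ : List (ℕ × ℕ), (((γ ++ [(i + 1, j + 1)]).map ζ).sum : ℤ)
        = ((γ.map ζ).sum : ℤ) + e i j := by
      intro γ; simp [he]
    refine ⟨fun γ hγ => ?_, ?_⟩
    · rcases hγ.eq_concat with ⟨-, h⟩ | ⟨γ', ⟨b1, b2⟩, rfl, hb, hc⟩
      · simp only [Prod.mk.injEq] at h
        omega
      · have hp := hpos hb
        rw [hs, lpp_succ]
        simp only [Prod.mk.injEq] at hc hp
        rcases hc with ⟨h1, h2⟩ | ⟨h1, h2⟩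
        · obtain ⟨b, rfl⟩ : ∃ b, b1 = b + 1 := ⟨b1 - 1, by omega⟩
          obtain ⟨rfl, rfl⟩ : i = b + 1 ∧ b2 = j + 1 := by omega
          have := (ih b j (by omega)).1 γ' hb
          omega
        · obtain ⟨b, rfl⟩ : ∃ b, b2 = b + 1 := ⟨b2 - 1, by omega⟩
          obtain ⟨rfl, rfl⟩ : j = b + 1 ∧ b1 = i + 1 := by omega
          have := (ih i b (by omega)).1 γ' hb
          omega
    · have hl : ∀ i j, 0 ≤ lpp e i j := lpp_nonneg fun i j => by simp [he]
      rw [lpp_succ]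
      -- The maximum is attained by extending an optimal path to the better neighbour.
      rcases le_total (lpp e (i + 1) j) (lpp e i (j + 1)) with hle | hle
      · rw [max_eq_left hle]
        cases i with
        | zero =>
          have hj : 0 < j := by omega
          obtain ⟨j, rfl⟩ : ∃ b, j = b + 1 := ⟨j - 1, by omega⟩
          obtain ⟨γ, hγ, hγs⟩ := (ih 0 j (by omega)).2
          refine ⟨_, hγ.concat (Or.inr rfl), ?_⟩
          rw [hs, hγs]
          have h1 := hl (0 + 1) (j + 1)
          rw [lpp_zero_left] at hle ⊢
          omega
        | succ i =>
          obtain ⟨γ, hγ, hγs⟩ := (ih i j (by omega)).2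
          exact ⟨_, hγ.concat (Or.inl rfl), by rw [hs, hγs]⟩
      · rw [max_eq_right hle]
        cases j with
        | zero =>
          obtain ⟨i, rfl⟩ : ∃ b, i = b + 1 := ⟨i - 1, by omega⟩
          obtain ⟨γ, hγ, hγs⟩ := (ih i 0 (by omega)).2
          refine ⟨_, hγ.concat (Or.inl rfl), ?_⟩
          rw [hs, hγs]
          have h1 := hl (i + 1) (0 + 1)
          rw [lpp_zero_right] at hle ⊢
          omega
        | succ j =>
          obtain ⟨γ, hγ, hγs⟩ := (ih i j (by omega)).2
          exact ⟨_, hγ.concat (Or.inr rfl), by rw [hs, hγs]⟩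

/-! ### Random environments -/

/-- The weights in the square `{1,…,n}²`, as a matrix with rows and columns numbered from `0`. -/
def weightMatrix (n : ℕ) (ζ : ℕ × ℕ → ℕ) (i j : ℕ) : ℤ :=
  if i < n ∧ j < n then (ζ (i + 1, j + 1) : ℤ) else 0

/-- The entry of a matrix that belongs to the vertex `p` of `{1,…,n}²`. -/
def vertexEntry (e : ℕ → ℕ → ℤ) (p : ℕ × ℕ) : ℤ := e (p.1 - 1) (p.2 - 1)

section Environment

variable {n : ℕ}

theorem mem_square {p : ℕ × ℕ} :
    p ∈ Finset.Icc (1, 1) (n, n) ↔ (1 ≤ p.1 ∧ 1 ≤ p.2) ∧ p.1 ≤ n ∧ p.2 ≤ n := by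
  rw [Finset.mem_Icc, Prod.le_def, Prod.le_def]

theorem isWeightMatrix_weightMatrix (ζ : ℕ × ℕ → ℕ) : IsWeightMatrix n (weightMatrix n ζ) where
  nonneg i j := by rw [weightMatrix]; split_ifs <;> positivity
  zero i j h := by rw [weightMatrix, if_neg (by omega)]

theorem vertexEntry_weightMatrix (ζ : ℕ × ℕ → ℕ) {p : ℕ × ℕ}
    (hp : p ∈ Finset.Icc (1, 1) (n, n)) : vertexEntry (weightMatrix n ζ) p = ζ p := by
  rw [mem_square] at hp
  rw [vertexEntry, weightMatrix, if_pos (by omega), Nat.sub_add_cancel hp.1.1,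
    Nat.sub_add_cancel hp.1.2]

theorem passageTime_eq_lpp_weightMatrix (hn : 1 ≤ n) (ζ : ℕ × ℕ → ℕ) :
    (passageTime ζ (1, 1) (n, n) : ℤ) = lpp (weightMatrix n ζ) n n := by
  obtain ⟨m, rfl⟩ : ∃ m, n = m + 1 := ⟨n - 1, by omega⟩
  rw [passageTime_eq_lpp]
  refine lpp_congr (a := m + 1) (b := m + 1) (fun i hi j hj => ?_) _ le_rfl _ le_rfl
  rw [weightMatrix, if_pos ⟨hi, hj⟩]

theorem IsWeightMatrix.ext {e e' : ℕ → ℕ → ℤ} (he : IsWeightMatrix n e)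
    (he' : IsWeightMatrix n e')
    (h : ∀ p ∈ Finset.Icc (1, 1) (n, n), vertexEntry e p = vertexEntry e' p) : e = e' := by
  funext i j
  by_cases hij : n ≤ i ∨ n ≤ j
  · rw [he.zero i j hij, he'.zero i j hij]
  · exact h (i + 1, j + 1) (mem_square.2 (by simp only; omega))

theorem IsWeightMatrix.vertexEntry_nonneg {e : ℕ → ℕ → ℤ} (he : IsWeightMatrix n e) (p : ℕ × ℕ) :
    0 ≤ vertexEntry e p := he.nonneg _ _

theorem total_eq_sum_square (e : ℕ → ℕ → ℤ) :
    total n e = ∑ p ∈ Finset.Icc (1, 1) (n, n), vertexEntry e p := by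
  rw [total, ← Finset.sum_product']
  refine Finset.sum_nbij' (fun p => (p.1 + 1, p.2 + 1)) (fun p => (p.1 - 1, p.2 - 1))
    (fun p hp => ?_) (fun p hp => ?_) (fun p hp => ?_) (fun p hp => ?_) (fun p hp => ?_)
  · simp only [Finset.mem_product, Finset.mem_range] at hp
    exact mem_square.2 (by simp only; omega)
  · rw [mem_square] at hp
    simp only [Finset.mem_product, Finset.mem_range]
    omega
  · simp
  · rw [mem_square] at hp
    ext <;> simp only <;> omega
  · simp [vertexEntry]

/-- A sum over a set with an involution `τ`, written as a sum over a set `P` of representatives of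
the orbits. -/
theorem sum_eq_sum_filter_of_involution {ι : Type*} {S : Finset ι} [DecidableEq ι] {τ : ι → ι}
    {P : ι → Prop} [DecidablePred P] (hτ : ∀ p ∈ S, τ p ∈ S) (hττ : ∀ p ∈ S, τ (τ p) = p)
    (hP : ∀ p ∈ S, ¬ P p ↔ P (τ p) ∧ τ p ≠ p) {f : ι → ℤ} (hf : ∀ p ∈ S, f (τ p) = f p) :
    ∑ p ∈ S, f p = ∑ p ∈ S with P p, (if τ p = p then 1 else 2) * f p := by
  rw [← Finset.sum_filter_add_sum_filter_not S P f]
  have h : ∑ p ∈ S with ¬ P p, f p = ∑ p ∈ S with P p, if τ p = p then 0 else f p := by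
    have : ∀ p, (if τ p = p then 0 else f p) = if τ p ≠ p then f p else 0 := fun p => by
      split_ifs <;> simp_all
    simp only [this]
    rw [← Finset.sum_filter]
    refine Finset.sum_nbij' τ τ (fun p hp => ?_) (fun p hp => ?_) (fun p hp => ?_) (fun p hp => ?_)
      (fun p hp => ?_) <;> simp only [Finset.mem_filter] at hp ⊢
    · have h := (hP p hp.1).1 hp.2
      exact ⟨⟨hτ p hp.1, h.1⟩, by rw [hττ p hp.1]; exact h.2.symm⟩
    · refine ⟨hτ p hp.1.1, (hP _ (hτ p hp.1.1)).2 ?_⟩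
      rw [hττ p hp.1.1]
      exact ⟨hp.1.2, hp.2.symm⟩
    · exact hττ p hp.1
    · exact hττ p hp.1.1
    · exact (hf p hp.1).symm
  rw [h, ← Finset.sum_add_distrib]
  refine Finset.sum_congr rfl fun p _ => ?_
  split_ifs <;> ring

variable {Ω : Type*} [MeasurableSpace Ω] {μ : Measure Ω} {w : ℕ × ℕ → Ω → ℕ}

/-- The joint distribution of independent geometric weights. -/
theorem measureReal_forall_eq_of_geo {T : Finset (ℕ × ℕ)} {Q : ℕ × ℕ → Prop}
    (hQ : ∀ p, p ∈ T ↔ Q p) {r : ℕ × ℕ → unitInterval} (hr : ∀ p ∈ T, r p < 1)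
    (hlaw : ∀ p ∈ T, HasLaw (w p) (geo (r p)) μ)
    (hind : iIndepFun (fun p : {p : ℕ × ℕ // Q p} => w p) μ) (m : ℕ × ℕ → ℕ) :
    NullMeasurableSet {ω | ∀ p ∈ T, w p ω = m p} μ ∧
      μ.real {ω | ∀ p ∈ T, w p ω = m p} =
        (∏ p ∈ T, (1 - (r p : ℝ))) * ∏ p ∈ T, (r p : ℝ) ^ m p := by
  have hset : {ω | ∀ p ∈ T, w p ω = m p} = ⋂ p ∈ T, w p ⁻¹' {m p} := by
    ext ω; simp
  constructor
  · rw [hset]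
    exact Finset.nullMeasurableSet_biInter T fun p hp =>
      (hlaw p hp).aemeasurable.nullMeasurable (measurableSet_singleton _)
  · let _ : Fintype {p : ℕ × ℕ // Q p} := Fintype.subtype T hQ
    have h := hind.measure_inter_preimage_eq_mul Finset.univ (sets := fun p => {m p})
      fun p _ => measurableSet_singleton _
    have hset' : {ω | ∀ p ∈ T, w p ω = m p} =
        ⋂ p ∈ (Finset.univ : Finset {p : ℕ × ℕ // Q p}), w p ⁻¹' {m p} := by
      ext ω; simp [hQ]
    rw [Measure.real, hset', h, ENNReal.toReal_prod, ← Finset.prod_mul_distrib,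
      Finset.prod_subtype T hQ]
    refine Finset.prod_congr rfl fun p _ => ?_
    have hp := (hQ p).2 p.2
    rw [← Measure.map_apply_of_aemeasurable (hlaw p hp).aemeasurable (measurableSet_singleton _),
      (hlaw p hp).map_eq, geo_singleton _ (hr p hp), ENNReal.toReal_ofReal]
    exact mul_nonneg (sub_nonneg.2 (r p).2.2) (pow_nonneg (r p).2.1 _)

/-- A random environment that is invariant under an involution `τ` of the square and otherwise
consists of independent geometric weights, with parameter `z` at the fixed points of `τ` and `z ^ 2`
elsewhere, gives every `τ`-invariant matrix a probability proportional to `z ^ total`. If these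
matrices correspond to plane partitions, the last passage time has a log-concave distribution. -/
theorem hasLogConcaveLaw_of_involution [IsProbabilityMeasure μ] (hn : 1 ≤ n)
    {τ : ℕ × ℕ → ℕ × ℕ} {P Q : ℕ × ℕ → Prop} {r : ℕ × ℕ → unitInterval} {z : ℝ} (hz : 0 ≤ z)
    {symm : Prop} {F : (ℕ → ℕ → ℤ) → ℕ → ℕ → ℤ}
    (hF : Set.BijOn F
      {e | IsWeightMatrix n e ∧
        ∀ p ∈ Finset.Icc (1, 1) (n, n), vertexEntry e (τ p) = vertexEntry e p}
      {ρ | IsPlanePartition n ρ ∧ (symm → ∀ i j, ρ i j = ρ j i)})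
    (hcorner : ∀ e, F e 0 0 = lpp e n n)
    (hdiag : ∀ e, IsWeightMatrix n e → diagonalSum n (F e) = total n e)
    (hτ : ∀ p ∈ Finset.Icc (1, 1) (n, n), τ p ∈ Finset.Icc (1, 1) (n, n))
    (hττ : ∀ p ∈ Finset.Icc (1, 1) (n, n), τ (τ p) = p)
    (hP : ∀ p ∈ Finset.Icc (1, 1) (n, n), ¬ P p ↔ P (τ p) ∧ τ p ≠ p)
    (hQ : ∀ p, Q p ↔ p ∈ Finset.Icc (1, 1) (n, n) ∧ P p)
    (hw : ∀ p ∈ Finset.Icc (1, 1) (n, n), w (τ p) = w p)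
    (hr : ∀ p, Q p → r p < 1) (hrz : ∀ p, Q p → (r p : ℝ) = z ^ (if τ p = p then 1 else 2))
    (hlaw : ∀ p, Q p → HasLaw (w p) (geo (r p)) μ)
    (hind : iIndepFun (fun p : {p : ℕ × ℕ // Q p} => w p) μ) :
    HasLogConcaveLaw (lastPassage n w) μ := by
  classical
  set T : Finset (ℕ × ℕ) := {p ∈ Finset.Icc (1, 1) (n, n) | P p} with hT
  have hTQ : ∀ p, p ∈ T ↔ Q p := fun p => by rw [hT, Finset.mem_filter, hQ]
  set W : Ω → ℕ → ℕ → ℤ := fun ω => weightMatrix n fun p => w p ω with hW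
  set 𝓜 : Set (ℕ → ℕ → ℤ) := {e | IsWeightMatrix n e ∧
    ∀ p ∈ Finset.Icc (1, 1) (n, n), vertexEntry e (τ p) = vertexEntry e p} with h𝓜
  have hW𝓜 : ∀ ω, W ω ∈ 𝓜 := fun ω => ⟨isWeightMatrix_weightMatrix _, fun p hp => by
    rw [hW, vertexEntry_weightMatrix _ (hτ p hp), vertexEntry_weightMatrix _ hp, hw p hp]⟩
  set c : ℝ := ∏ p ∈ T, (1 - (r p : ℝ)) with hc
  have hc0 : 0 ≤ c := Finset.prod_nonneg fun p _ => sub_nonneg.2 (r p).2.2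
  have hevent : ∀ e ∈ 𝓜, {ω | W ω = e} =
      {ω | ∀ p ∈ T, w p ω = (vertexEntry e p).toNat} := by
    intro e he
    ext ω
    constructor
    · rintro rfl p hp
      rw [hW, vertexEntry_weightMatrix _ (Finset.mem_filter.1 hp).1, Int.toNat_natCast]
    · intro h
      have h' : ∀ p ∈ T, (w p ω : ℤ) = vertexEntry e p := fun p hp => by
        rw [h p hp, Int.toNat_of_nonneg (he.1.vertexEntry_nonneg p)]
      refine (hW𝓜 ω).1.ext he.1 fun p hp => ?_
      rw [hW, vertexEntry_weightMatrix _ hp]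
      by_cases hPp : P p
      · exact h' p (Finset.mem_filter.2 ⟨hp, hPp⟩)
      · have := h' (τ p) (Finset.mem_filter.2 ⟨hτ p hp, ((hP p hp).1 hPp).1⟩)
        rwa [hw p hp, he.2 p hp] at this
  have hprob : ∀ e ∈ 𝓜, NullMeasurableSet {ω | W ω = e} μ ∧
      μ.real {ω | W ω = e} = c * z ^ (total n e).toNat := by
    intro e he
    have h := measureReal_forall_eq_of_geo hTQ (fun p hp => hr p ((hTQ p).1 hp))
      (fun p hp => hlaw p ((hTQ p).1 hp)) hind fun p => (vertexEntry e p).toNat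
    rw [hevent e he]
    refine ⟨h.1, h.2.trans ?_⟩
    congr 1
    have hexp : (total n e).toNat =
        ∑ p ∈ T, (if τ p = p then 1 else 2) * (vertexEntry e p).toNat := by
      have h1 := sum_eq_sum_filter_of_involution hτ hττ hP he.2
      rw [← total_eq_sum_square] at h1
      zify
      rw [Int.toNat_of_nonneg he.1.total_nonneg, h1]
      refine Finset.sum_congr rfl fun p _ => ?_
      rw [Int.toNat_of_nonneg (he.1.vertexEntry_nonneg p)]
    rw [hexp, ← Finset.prod_pow_eq_pow_sum]
    refine Finset.prod_congr rfl fun p hp => ?_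
    rw [hrz p ((hTQ p).1 hp), ← pow_mul]
  have hbij : ∀ k, Set.BijOn F {e | e ∈ 𝓜 ∧ lpp e n n = k} (planePartitions n symm k) := by
    intro k
    refine ⟨fun e he => ⟨hF.mapsTo he.1, (hcorner e).trans he.2⟩,
      hF.injOn.mono fun e he => he.1, fun ρ hρ => ?_⟩
    obtain ⟨e, he, rfl⟩ := hF.surjOn hρ.1
    exact ⟨e, ⟨he, (hcorner e).symm.trans hρ.2⟩, rfl⟩
  have hpmf : ∀ k : ℤ, μ.real {ω | (lastPassage n w ω : ℤ) = k} = c * traceCount n symm z k := by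
    intro k
    have hfin : {e | e ∈ 𝓜 ∧ lpp e n n = k}.Finite :=
      Set.Finite.of_injOn (hbij k).mapsTo (hbij k).injOn (finite_planePartitions n symm k)
    have hunion : {ω | (lastPassage n w ω : ℤ) = k} = ⋃ e ∈ hfin.toFinset, {ω | W ω = e} := by
      ext ω
      simp only [Set.mem_iUnion, Set.Finite.mem_toFinset, Set.mem_ofPred_eq, exists_prop,
        exists_eq_right', hW𝓜 ω, true_and]
      rw [lastPassage, passageTime_eq_lpp_weightMatrix hn]
    rw [hunion, measureReal_biUnion_finset₀]
    · rw [traceCount, ← finsum_mem_eq_of_bijOn (f := fun e => z ^ (total n e).toNat) F (hbij k)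
        fun e he => by rw [hdiag e he.1.1], finsum_mem_eq_finite_toFinset_sum _ hfin,
        Finset.mul_sum]
      exact Finset.sum_congr rfl fun e he => (hprob e (hfin.mem_toFinset.1 he).1).2
    · intro e _ e' _ hee'
      refine Disjoint.aedisjoint (Set.disjoint_left.2 fun ω h h' => hee' ?_)
      exact h.symm.trans h'
    · exact fun e he => (hprob e (hfin.mem_toFinset.1 he).1).1
  rw [HasLogConcaveLaw, funext hpmf]
  exact (isLogConcaveSeq_traceCount hn symm hz).const_mul hc0

theorem unitSqrt_lt_one {q : unitInterval} (hq : q < 1) : unitSqrt q < 1 := by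
  have hq' : (q : ℝ) < 1 := hq
  have : √(q : ℝ) < 1 := by
    rw [Real.sqrt_lt' one_pos]
    simpa using hq'
  exact this

theorem diagonalSum_toPlanePartition {e : ℕ → ℕ → ℤ} (he : IsWeightMatrix n e) :
    diagonalSum n (toPlanePartition n e) = total n e :=
  sum_toPlanePartition_diag he.nonneg

end Environment

theorem mainTheorem4 (n : ℕ) (hn : 1 ≤ n) (q : unitInterval) (hq : q < 1)
    {Ω : Type*} [MeasurableSpace Ω] (μ : Measure Ω) [IsProbabilityMeasure μ]
    (w : ℕ × ℕ → Ω → ℕ) :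
    (IsAntiSymmetricEnvironment n q w μ → HasLogConcaveLaw (lastPassage n w) μ) ∧
    (IsIIDEnvironment n q w μ → HasLogConcaveLaw (lastPassage n w) μ) ∧
    (IsSymmetricEnvironment n q w μ → HasLogConcaveLaw (lastPassage n w) μ) := by
  have hsqrt : ((unitSqrt q : unitInterval) : ℝ) ^ 2 = q := Real.sq_sqrt q.2.1
  have hmem : ∀ p : ℕ × ℕ, p ∈ Set.Icc (1, 1) (n, n) ↔ p ∈ Finset.Icc (1, 1) (n, n) := fun p => by
    rw [Finset.mem_Icc, Set.mem_Icc]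
  refine ⟨fun h => ?_, fun h => ?_, fun h => ?_⟩
  · have hset : {e | IsWeightMatrix n e ∧ IsAntiSymmetric n e} = {e | IsWeightMatrix n e ∧
        ∀ p ∈ Finset.Icc (1, 1) (n, n),
          vertexEntry e (n + 1 - p.2, n + 1 - p.1) = vertexEntry e p} := by
      ext e
      refine and_congr_right fun he => ⟨fun ha p hp => ?_, fun ha i hi j hj => ?_⟩
      · rw [mem_square] at hp
        rw [vertexEntry, vertexEntry, ha (p.1 - 1) (by omega) (p.2 - 1) (by omega)]
        congr 1 <;> simp only <;> omega
      · have := ha (i + 1, j + 1) (mem_square.2 (by simp only; omega))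
        simp only [vertexEntry, Nat.add_sub_cancel] at this
        rw [← this]
        congr 1 <;> omega
    refine hasLogConcaveLaw_of_involution hn (τ := fun p => (n + 1 - p.2, n + 1 - p.1))
      (P := fun p => p.1 + p.2 ≤ n + 1)
      (r := fun p => if p.1 + p.2 = n + 1 then unitSqrt q else q)
      (z := unitSqrt q) (unitSqrt q).2.1 (hset ▸ bijOn_doubledTableau n) (fun e => ?_)
      (fun e he => ?_) (fun p hp => ?_) (fun p hp => ?_) (fun p hp => ?_) (fun p => ?_)
      (fun p hp => (h.symm p.1 p.2 ((hmem p).2 hp)).symm) (fun p _ => ?_) (fun p hp => ?_)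
      (fun p hp => ?_) h.indep
    · simp [doubledTableau, toPlanePartition_zero_zero]
    · rw [← diagonalSum_toPlanePartition he]
      simp [diagonalSum, doubledTableau]
    · rw [mem_square] at hp ⊢
      simp only
      omega
    · rw [mem_square] at hp
      ext <;> simp only <;> omega
    · rw [mem_square] at hp
      simp only [ne_eq, Prod.ext_iff]
      omega
    · rw [hmem]
    · split_ifs
      exacts [unitSqrt_lt_one hq, hq]
    · have hp' := mem_square.1 ((hmem p).1 hp.1)
      have hfix : ((n + 1 - p.2, n + 1 - p.1) = p) ↔ p.1 + p.2 = n + 1 := by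
        rw [Prod.ext_iff]
        simp only
        omega
      simp only [hfix]
      split_ifs
      · rw [pow_one]
      · rw [hsqrt]
    · have hp2 := hp.2
      split_ifs with hpn
      · exact h.law_anti p.1 p.2 hp.1 hpn
      · exact h.law_off p.1 p.2 hp.1 (by omega)
  · have hset : {e | IsWeightMatrix n e ∧ (False → ∀ i j, e i j = e j i)} =
        {e | IsWeightMatrix n e ∧
          ∀ p ∈ Finset.Icc (1, 1) (n, n), vertexEntry e (id p) = vertexEntry e p} := by
      ext e; simp
    exact hasLogConcaveLaw_of_involution hn (τ := id) (P := fun _ => True) (r := fun _ => q)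
      (z := q) q.2.1 (hset ▸ bijOn_toPlanePartition n False)
      (fun e => toPlanePartition_zero_zero) (fun e he => diagonalSum_toPlanePartition he)
      (fun p hp => hp) (fun p hp => rfl) (fun p hp => by simp) (fun p => by rw [hmem]; simp)
      (fun p hp => rfl) (fun p hp => hq) (fun p hp => by simp) h.law h.indep
  · have hset : {e | IsWeightMatrix n e ∧ (True → ∀ i j, e i j = e j i)} =
        {e | IsWeightMatrix n e ∧
          ∀ p ∈ Finset.Icc (1, 1) (n, n), vertexEntry e p.swap = vertexEntry e p} := by
      ext e
      refine and_congr_right fun he => ⟨fun hs p _ => hs trivial _ _, fun hs _ i j => ?_⟩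
      by_cases hij : n ≤ i ∨ n ≤ j
      · rw [he.zero i j hij, he.zero j i hij.symm]
      · exact (hs (i + 1, j + 1) (mem_square.2 (by simp only; omega))).symm
    refine hasLogConcaveLaw_of_involution hn (τ := Prod.swap) (P := fun p => p.1 ≤ p.2)
      (r := fun p => if p.1 = p.2 then unitSqrt q else q)
      (z := unitSqrt q) (unitSqrt q).2.1 (hset ▸ bijOn_toPlanePartition n True)
      (fun e => toPlanePartition_zero_zero) (fun e he => diagonalSum_toPlanePartition he)
      (fun p hp => ?_) (fun p hp => p.swap_swap) (fun p hp => ?_) (fun p => ?_)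
      (fun p hp => (h.symm p.1 p.2 ((hmem p).2 hp)).symm) (fun p _ => ?_) (fun p hp => ?_)
      (fun p hp => ?_) h.indep
    · rw [mem_square] at hp ⊢
      exact ⟨hp.1.symm, hp.2.symm⟩
    · simp only [Prod.fst_swap, Prod.snd_swap, ne_eq, Prod.ext_iff]
      omega
    · rw [hmem]
    · split_ifs
      exacts [unitSqrt_lt_one hq, hq]
    · have hfix : p.swap = p ↔ p.1 = p.2 := by
        rw [Prod.ext_iff]
        simp only [Prod.fst_swap, Prod.snd_swap]
        omega
      simp only [hfix]
      split_ifs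
      · rw [pow_one]
      · rw [hsqrt]
    · split_ifs with hpe
      · have := h.law_diag p.1 (by
          have := hp.1
          rw [Set.mem_Icc, Prod.le_def, Prod.le_def] at this ⊢
          simp only at this ⊢
          omega)
        rwa [show ((p.1, p.1) : ℕ × ℕ) = p from Prod.ext rfl hpe] at this
      · exact h.law_off p.1 p.2 hp.1 hpe
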